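/- Let $T$ be Thompson's group of homeomorphisms of the circle $\mathbb R/\mathbb Z$ that preserve the set of dyadic points and are piecewise linear with finitely many breakpoints, all dyadic, and slopes integer powers of $2$. A pair of full binary trees with the same number of leaves, together with a cyclic identification of their leaves, represents the element of $T$ that maps the standard dyadic interval of each leaf of the first tree linearly onto that of the corresponding leaf of the second. Every element has a unique reduced such tree diagram, i.e. one in which no two sibling leaves of the first tree are identified, left with left and right with right, with two sibling leaves of the second tree. Its diagram is the directed graph obtained from the two trees by identifying corresponding leaves; edges point away from the roots, left edges are labeled $0$ and right edges $1$. Let $H\le T$ be generated by a (finite or infinite) set $G\subseteq T$. The core of $H$ (with respect to $G$) is the labeled directed graph obtained from the disjoint union of the reduced diagrams of the elements of $G$ by identifying all the roots (to one vertex $e$; if $G=\emptyset$ the core is the single vertex $e$) and then making repeatedly the following identifications: (1) if two vertices are identified, identify their left children and left edges, and their right children and right edges; (2) if two vertices have their left children identified and their right children identified, identify the two vertices. An element of $T$ is accepted by the core if there is a homomorphism of labeled directed graphs from its reduced diagram to the core that sends the roots to $e$. Let $C(H)$ be the set of accepted elements. For a semigroup presentation $\mathcal P=\langle X\mid R\rangle$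 and a word $u$ over $X$, let $\mathcal D^a(\mathcal P,u)$ be the annular diagram group: its elements are the annular diagrams over $\mathcal P$ whose outer and inner boundary paths, read from distinguished outer and inner vertices, have label $u$, modulo insertion and removal of dipoles; the product is given by nesting one annulus in the other. If $H=C(H)$, then $H$ is an annular diagram group. More precisely, $$H\;\cong\;\mathcal D^a(\langle S\mid R\rangle,\,e),$$ where $S$ is the set of vertices of the core and $R$ consists of the relations $x=yz$, one for each caret of the core with root $x$, left child $y$ and right child $z$. -/

import Mathlib

/-!
Thompson's group `T`, its tree diagrams, the Stallings 2-core of a subgroup of `T`,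
and annular diagram groups over semigroup presentations.
-/

namespace StallingsCore

open Set Filter Topology

/-! ### Thompson's group `T` -/

/-- A point of the circle `ℝ/ℤ` is dyadic if it is the class of some `k / 2 ^ n`. -/
def IsDyadic (x : UnitAddCircle) : Prop :=
  ∃ (k : ℤ) (n : ℕ), x = (((k : ℝ) / 2 ^ n : ℝ) : UnitAddCircle)

/-- A homeomorphism of the circle is dyadic piecewise linear if it preserves the set of dyadic
points and, away from finitely many dyadic points, it is locally affine with slope an integer
power of `2`. -/
def IsDyadicPL (f : UnitAddCircle ≃ₜ UnitAddCircle) : Prop :=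
  (∀ x, IsDyadic (f x) ↔ IsDyadic x) ∧
  ∃ B : Set UnitAddCircle, B.Finite ∧ (∀ x ∈ B, IsDyadic x) ∧
    ∀ x, x ∉ B → ∃ k : ℤ, ∀ᶠ t : ℝ in 𝓝 0,
      f (x + (t : UnitAddCircle)) = f x + (((2 : ℝ) ^ k * t : ℝ) : UnitAddCircle)

/-- Thompson's group `T`: the dyadic piecewise linear homeomorphisms of the circle
under composition. -/
def ThompsonT : Subgroup (UnitAddCircle ≃ₜ UnitAddCircle) where
  carrier := {f | IsDyadicPL f}
  one_mem' := by
    refine ⟨fun x => Iff.rfl, ∅, Set.finite_empty, by simp, fun x _ => ⟨0, ?_⟩⟩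
    exact Eventually.of_forall fun t => by simp
  mul_mem' := by
    rintro f g ⟨hf, Bf, hBf, hBf', hf'⟩ ⟨hg, Bg, hBg, hBg', hg'⟩
    refine ⟨fun x => (hf (g x)).trans (hg x), Bg ∪ g ⁻¹' Bf,
      hBg.union (hBf.preimage g.injective.injOn), ?_, ?_⟩
    · rintro x (hx | hx)
      · exact hBg' x hx
      · exact (hg x).1 (hBf' _ hx)
    · intro x hx
      simp only [Set.mem_union, Set.mem_preimage, not_or] at hx
      obtain ⟨k, hk⟩ := hg' x hx.1
      obtain ⟨l, hl⟩ := hf' (g x) hx.2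
      refine ⟨l + k, ?_⟩
      have hc : Tendsto (fun t : ℝ => (2 : ℝ) ^ k * t) (𝓝 0) (𝓝 0) := by
        have : Continuous fun t : ℝ => (2 : ℝ) ^ k * t := by fun_prop
        simpa using this.tendsto 0
      filter_upwards [hk, hc.eventually hl] with t h1 h2
      change f (g (x + t)) = f (g x) + _
      rw [h1, h2, ← mul_assoc, zpow_add₀ (by norm_num)]
  inv_mem' := by
    rintro f ⟨hf, B, hB, hB', hf'⟩
    refine ⟨fun x => ?_, f '' B, hB.image f, ?_, ?_⟩
    · have := hf (f.symm x)
      rw [f.apply_symm_apply] at this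
      exact this.symm
    · rintro _ ⟨x, hx, rfl⟩
      exact (hf x).2 (hB' x hx)
    · intro y hy
      have hx : f.symm y ∉ B := fun h => hy ⟨_, h, f.apply_symm_apply y⟩
      obtain ⟨k, hk⟩ := hf' _ hx
      refine ⟨-k, ?_⟩
      have hc : Tendsto (fun t : ℝ => (2 : ℝ) ^ (-k) * t) (𝓝 0) (𝓝 0) := by
        have : Continuous fun t : ℝ => (2 : ℝ) ^ (-k) * t := by fun_prop
        simpa using this.tendsto 0
      filter_upwards [hc.eventually hk] with t h
      change f.symm (y + t) = f.symm y + _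
      rw [f.apply_symm_apply, ← mul_assoc, ← zpow_add₀ (by norm_num)] at h
      simp only [add_neg_cancel, zpow_zero, one_mul] at h
      rw [← h, f.symm_apply_apply]

/-! ### Tree diagrams -/

/-- Full (finite, rooted, ordered) binary trees. -/
inductive FullTree : Type
  | leaf : FullTree
  | caret : FullTree → FullTree → FullTree

namespace FullTree

/-- The leaves of a tree from left to right. A vertex is recorded by the label of the path
from the root to it: `false` (the label `0`) for a left edge, `true` (the label `1`) for
a right edge. -/
def leaves : FullTree → List (List Bool)
  | leaf => [[]]
  | caret l r => l.leaves.map (List.cons false) ++ r.leaves.map (List.cons true)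

/-- All vertices of a tree (leaves, inner vertices and the root), as paths from the root. -/
def vertices : FullTree → Set (List Bool)
  | leaf => {[]}
  | caret l r => {[]} ∪ List.cons false '' l.vertices ∪ List.cons true '' r.vertices

end FullTree

/-- The left endpoint of the dyadic interval of a vertex: the root has `[0, 1)`, and the left
and right children of a vertex have the left and right halves of its interval. -/
noncomputable def leftEnd : List Bool → ℝ
  | [] => 0
  | b :: w => ((if b then 1 else 0) + leftEnd w) / 2

/-- The length of the dyadic interval of a vertex. -/
noncomputable def intervalLength (w : List Bool) : ℝ := (1 / 2) ^ w.length

/-- A pair of trees `(R, S, n)`: an input tree `R` and an output tree `S` with the same number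
of leaves, and the (zero-based) index of the leaf of `S` identified with the first leaf of `R`. -/
structure TreeDiagram : Type where
  input : FullTree
  output : FullTree
  offset : ℕ
  same_leaves : input.leaves.length = output.leaves.length
  offset_lt : offset < output.leaves.length

namespace TreeDiagram

/-- The pairs (leaf of the input tree, leaf of the output tree) that are identified: the first
leaf of `R` with the leaf of `S` of index `offset`, and so on cyclically. -/
def leafPairs (D : TreeDiagram) : List (List Bool × List Bool) :=
  D.input.leaves.zip (D.output.leaves.rotate D.offset)

/-- The tree diagram represents `f` if `f` maps the interval of each leaf of the input tree
linearly onto the interval of the leaf of the output tree identified with it. -/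
def Represents (D : TreeDiagram) (f : ThompsonT) : Prop :=
  ∀ e ∈ D.leafPairs, ∀ t ∈ Set.Ico (0 : ℝ) 1,
    f.1 ((leftEnd e.1 + t * intervalLength e.1 : ℝ) : UnitAddCircle) =
      ((leftEnd e.2 + t * intervalLength e.2 : ℝ) : UnitAddCircle)

/-- A tree diagram is reduced if no dipole can be removed: there are no two carets of leaves,
one in each tree, whose left leaves are identified and whose right leaves are identified. -/
def IsReduced (D : TreeDiagram) : Prop :=
  ¬ ∃ u v : List Bool, (u ++ [false], v ++ [false]) ∈ D.leafPairs ∧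
    (u ++ [true], v ++ [true]) ∈ D.leafPairs

/-- The input tree (`false`) or the output tree (`true`). -/
def tree (D : TreeDiagram) (side : Bool) : FullTree :=
  if side then D.output else D.input

end TreeDiagram

/-! ### The Stallings 2-core -/

/-- The reduced tree diagrams of the elements of `G` (each element has exactly one). -/
def ReducedDiagramOf (G : Set ThompsonT) : Type :=
  {D : TreeDiagram // D.IsReduced ∧ ∃ g ∈ G, D.Represents g}

/-- The vertices before any identification: the vertices of the two trees of every reduced
diagram of an element of `G`, and a base vertex with which all the roots get identified
(so that the core of the empty family is a single vertex). -/
inductive PreVertex (G : Set ThompsonT) : Type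
  | base : PreVertex G
  | vert (D : ReducedDiagramOf G) (side : Bool) (w : List Bool)
      (hw : w ∈ (D.1.tree side).vertices) : PreVertex G

/-- `IsChild b x y`: `y` is the left (`b = false`) or right (`b = true`) child of `x`
in one of the trees. -/
inductive IsChild {G : Set ThompsonT} (b : Bool) : PreVertex G → PreVertex G → Prop
  | mk (D : ReducedDiagramOf G) (side : Bool) (w : List Bool)
      (hw : w ∈ (D.1.tree side).vertices) (hw' : w ++ [b] ∈ (D.1.tree side).vertices) :
      IsChild b (.vert D side w hw) (.vert D side (w ++ [b]) hw')

/-- The identifications made in the construction of the core. -/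
inductive Identified {G : Set ThompsonT} : PreVertex G → PreVertex G → Prop
  | refl (x) : Identified x x
  | symm {x y} : Identified x y → Identified y x
  | trans {x y z} : Identified x y → Identified y z → Identified x z
  /-- All roots are identified. -/
  | root (D : ReducedDiagramOf G) (side : Bool) (hw : [] ∈ (D.1.tree side).vertices) :
      Identified (.vert D side [] hw) .base
  /-- Within a diagram, corresponding leaves of the two trees are identified. -/
  | leaf (D : ReducedDiagramOf G) (u v : List Bool) (h : (u, v) ∈ D.1.leafPairs)
      (hu : u ∈ (D.1.tree false).vertices) (hv : v ∈ (D.1.tree true).vertices) :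
      Identified (.vert D false u hu) (.vert D true v hv)
  /-- If two vertices are identified, then so are their left children, and so are their
  right children. -/
  | child {x x' y y'} (b : Bool) : Identified x x' → IsChild b x y → IsChild b x' y' →
      Identified y y'
  /-- If the left children and the right children of two vertices are identified respectively,
  then so are the two vertices. -/
  | parent {x x' l l' r r'} : IsChild false x l → IsChild true x r →
      IsChild false x' l' → IsChild true x' r' → Identified l l' → Identified r r' →
      Identified x x'

/-- The identifications as an equivalence relation. -/
def coreSetoid (G : Set ThompsonT) : Setoid (PreVertex G) :=
  ⟨Identified, Identified.refl, Identified.symm, Identified.trans⟩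

/-- The vertices of the core of the subgroup generated by `G`. -/
def CoreVertex (G : Set ThompsonT) : Type := Quotient (coreSetoid G)

/-- The root of the core. -/
def coreRoot (G : Set ThompsonT) : CoreVertex G := Quotient.mk (coreSetoid G) .base

/-- The labeled directed edges of the core: `CoreEdge G b x y` says that there is an edge with
label `b` from `x` to `y`. -/
def CoreEdge (G : Set ThompsonT) (b : Bool) (x y : CoreVertex G) : Prop :=
  ∃ x' y' : PreVertex G, IsChild b x' y' ∧
    Quotient.mk (coreSetoid G) x' = x ∧ Quotient.mk (coreSetoid G) y' = y

/-- A homomorphism of labeled directed graphs from the diagram of `D` (its two trees with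
corresponding leaves identified) to the core, sending roots to the root. The value of `φ` at
words that are not vertices is irrelevant. -/
structure IsCoreHom (G : Set ThompsonT) (D : TreeDiagram)
    (φ : Bool → List Bool → CoreVertex G) : Prop where
  map_root : ∀ side, φ side [] = coreRoot G
  map_edge : ∀ side w b, w ++ [b] ∈ (D.tree side).vertices →
    CoreEdge G b (φ side w) (φ side (w ++ [b]))
  map_leaf : ∀ u v, (u, v) ∈ D.leafPairs → φ false u = φ true v

/-- The set of the elements of `T` accepted by the core: those whose reduced diagram has
a homomorphism to the core. -/
def coreAccepted (G : Set ThompsonT) : Set ThompsonT :=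
  {f | ∃ D : TreeDiagram, D.IsReduced ∧ D.Represents f ∧ ∃ φ, IsCoreHom G D φ}

/-! ### Annular diagram groups -/

/-- A semigroup presentation with alphabet `X`: a set of relations `r = s` between
nonempty words. -/
structure SemigroupPresentation (X : Type*) where
  rels : Set (List X × List X)
  ne_nil : ∀ e ∈ rels, e.1 ≠ [] ∧ e.2 ≠ []

/-- There is a (positive or negative) cell with outer path `r` and inner path `s`. -/
def SemigroupPresentation.IsCell {X : Type*} (P : SemigroupPresentation X) (r s : List X) :
    Prop :=
  (r, s) ∈ P.rels ∨ (s, r) ∈ P.rels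

/-- Annular diagrams over `P`, written from the outside to the inside. In `AnnularDiagram P u v`
the outer path, read from the outer vertex, has label `u` and the inner path, read from the inner
vertex, has label `v`. Every annular diagram is obtained by nesting annular diagrams with at most
one cell. (The endpoints are recorded through equations to avoid transport along identities
between concatenations.) -/
inductive AnnularDiagram {X : Type*} (P : SemigroupPresentation X) : List X → List X → Type _
  /-- The annulus of width zero: the two paths, and the two vertices, coincide. -/
  | nil (u : List X) : AnnularDiagram P u u
  /-- One cell: the outer path is `p r q`, the inner path is `p s q`, both have the initial
  vertex of `p` as distinguished vertex, and the cell is attached along `r` and `s`. -/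
  | cell {u v : List X} (p q : List X) {r s : List X} (h : P.IsCell r s)
      (hu : u = p ++ r ++ q) (hv : v = p ++ s ++ q) : AnnularDiagram P u v
  /-- No cell, but different distinguished vertices: a circle with label `p q` from the outer
  vertex, on which the inner vertex is the end point of `p`. -/
  | shift {u v : List X} (p q : List X) (hu : u = p ++ q) (hv : v = q ++ p) :
      AnnularDiagram P u v
  /-- Put the second annulus inside the first, identifying the inner path and inner vertex of
  the first with the outer path and outer vertex of the second. -/
  | comp {u v w : List X} : AnnularDiagram P u v → AnnularDiagram P v w → AnnularDiagram P u w

namespace AnnularDiagram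

variable {X : Type*} {P : SemigroupPresentation X}

/-- Equality of annular diagrams as labeled graphs in the annulus, together with removal and
insertion of dipoles. -/
inductive Equivalent : ∀ {u v : List X}, AnnularDiagram P u v → AnnularDiagram P u v → Prop
  | refl {u v} (a : AnnularDiagram P u v) : Equivalent a a
  | symm {u v} {a b : AnnularDiagram P u v} : Equivalent a b → Equivalent b a
  | trans {u v} {a b c : AnnularDiagram P u v} :
      Equivalent a b → Equivalent b c → Equivalent a c
  | comp_congr {u v w} {a a' : AnnularDiagram P u v} {b b' : AnnularDiagram P v w} :
      Equivalent a a' → Equivalent b b' → Equivalent (comp a b) (comp a' b')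
  | nil_comp {u v} (a : AnnularDiagram P u v) : Equivalent (comp (nil u) a) a
  | comp_nil {u v} (a : AnnularDiagram P u v) : Equivalent (comp a (nil v)) a
  | assoc {u v w x} (a : AnnularDiagram P u v) (b : AnnularDiagram P v w)
      (c : AnnularDiagram P w x) : Equivalent (comp (comp a b) c) (comp a (comp b c))
  /-- Moving the distinguished vertex once around the circle changes nothing. -/
  | shift_full {u : List X} (p : List X) (hu : u = p ++ []) (hv : u = [] ++ p) :
      Equivalent (shift p [] hu hv) (nil u)
  /-- Moving the distinguished vertex along `p` and then along `q` is moving it along `p q`. -/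
  | shift_shift {u v w : List X} (p q t : List X) (h₁ : u = p ++ (q ++ t))
      (h₂ : v = (q ++ t) ++ p) (h₃ : v = q ++ (t ++ p)) (h₄ : w = (t ++ p) ++ q)
      (h₅ : u = (p ++ q) ++ t) (h₆ : w = t ++ (p ++ q)) :
      Equivalent (comp (shift p (q ++ t) h₁ h₂) (shift q (t ++ p) h₃ h₄))
        (shift (p ++ q) t h₅ h₆)
  /-- Attaching a cell does not depend on the choice of the distinguished vertex. -/
  | shift_cell {u v v' w : List X} (p q t : List X) {r s : List X} (h : P.IsCell r s)
      (h₁ : u = (p ++ r ++ q) ++ t) (h₂ : v = t ++ (p ++ r ++ q))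
      (h₃ : v = (t ++ p) ++ r ++ q) (h₄ : w = (t ++ p) ++ s ++ q)
      (h₅ : u = p ++ r ++ (q ++ t)) (h₆ : v' = p ++ s ++ (q ++ t))
      (h₇ : v' = (p ++ s ++ q) ++ t) (h₈ : w = t ++ (p ++ s ++ q)) :
      Equivalent (comp (shift (p ++ r ++ q) t h₁ h₂) (cell (t ++ p) q h h₃ h₄))
        (comp (cell p (q ++ t) h h₅ h₆) (shift (p ++ s ++ q) t h₇ h₈))
  /-- Cells attached along disjoint paths may be attached in either order. -/
  | disjoint {u v v' w : List X} (p m q : List X) {r s r' s' : List X}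
      (h : P.IsCell r s) (h' : P.IsCell r' s')
      (h₁ : u = p ++ r ++ (m ++ r' ++ q)) (h₂ : v = p ++ s ++ (m ++ r' ++ q))
      (h₃ : v = (p ++ s ++ m) ++ r' ++ q) (h₄ : w = (p ++ s ++ m) ++ s' ++ q)
      (h₅ : u = (p ++ r ++ m) ++ r' ++ q) (h₆ : v' = (p ++ r ++ m) ++ s' ++ q)
      (h₇ : v' = p ++ r ++ (m ++ s' ++ q)) (h₈ : w = p ++ s ++ (m ++ s' ++ q)) :
      Equivalent (comp (cell p (m ++ r' ++ q) h h₁ h₂) (cell (p ++ s ++ m) q h' h₃ h₄))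
        (comp (cell (p ++ r ++ m) q h' h₅ h₆) (cell p (m ++ s' ++ q) h h₇ h₈))
  /-- Two cells, the inner path of the first being the outer path of the second, with labels
  `r, s` and `s, r`, form a dipole and can be removed. -/
  | dipole {u v : List X} (p q : List X) {r s : List X} (h : P.IsCell r s) (h' : P.IsCell s r)
      (hu : u = p ++ r ++ q) (hv : v = p ++ s ++ q) :
      Equivalent (comp (cell p q h hu hv) (cell p q h' hv hu)) (nil u)

/-- Exchange the inside and the outside of an annular diagram. -/
def reverse : ∀ {u v : List X}, AnnularDiagram P u v → AnnularDiagram P v u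
  | _, _, nil u => nil u
  | _, _, cell p q h hu hv => cell p q h.symm hv hu
  | _, _, shift p q hu hv => shift q p hv hu
  | _, _, comp a b => comp b.reverse a.reverse

theorem shift_comp_shift {u v : List X} (p q : List X) (hu : u = p ++ q) (hv : v = q ++ p) :
    Equivalent (comp (shift (P := P) p q hu hv) (shift q p hv hu)) (nil u) := by
  have key : ∀ q' : List X, q' = q ++ [] → ∀ (h₁ : u = p ++ q') (h₂ : v = q' ++ p),
      Equivalent (comp (shift (P := P) p q' h₁ h₂) (shift q p hv hu)) (nil u) := by
    rintro _ rfl h₁ h₂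
    exact (Equivalent.shift_shift p q [] h₁ h₂ hv hu (by simpa using hu) hu).trans
      (Equivalent.shift_full (p ++ q) _ _)
  exact key q (by simp) hu hv

theorem comp_reverse {u v : List X} (a : AnnularDiagram P u v) :
    Equivalent (comp a a.reverse) (nil u) := by
  induction a with
  | nil u => exact .nil_comp _
  | cell p q h hu hv => exact .dipole p q h h.symm hu hv
  | shift p q hu hv => exact shift_comp_shift p q hu hv
  | comp a b iha ihb =>
    refine (Equivalent.assoc a b _).trans (.trans (.comp_congr (.refl a) ?_) iha)
    exact (Equivalent.assoc b _ _).symm.trans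
      ((Equivalent.comp_congr ihb (.refl _)).trans (.nil_comp _))

theorem reverse_reverse {u v : List X} (a : AnnularDiagram P u v) : a.reverse.reverse = a := by
  induction a with
  | nil u => rfl
  | cell p q h hu hv => rfl
  | shift p q hu hv => rfl
  | comp a b iha ihb => simp only [reverse, iha, ihb]

theorem reverse_comp {u v : List X} (a : AnnularDiagram P u v) :
    Equivalent (comp a.reverse a) (nil v) := by
  simpa only [reverse_reverse] using comp_reverse a.reverse

theorem Equivalent.reverse {u v : List X} {a b : AnnularDiagram P u v} (h : Equivalent a b) :
    Equivalent a.reverse b.reverse :=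
  (Equivalent.comp_nil a.reverse).symm.trans <|
    (Equivalent.comp_congr (.refl _) (comp_reverse b).symm).trans <|
    (Equivalent.assoc _ _ _).symm.trans <|
    (Equivalent.comp_congr (.comp_congr (.refl _) h.symm) (.refl _)).trans <|
    (Equivalent.comp_congr (reverse_comp a) (.refl _)).trans (.nil_comp _)

/-- Annular diagrams up to equivalence. -/
def setoid (P : SemigroupPresentation X) (u v : List X) : Setoid (AnnularDiagram P u v) :=
  ⟨Equivalent, Equivalent.refl, Equivalent.symm, Equivalent.trans⟩

end AnnularDiagram

/-- The annular diagram group `𝒟ᵃ(P, u)`: annular `(u, u)`-diagrams over `P` modulo dipoles. -/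
def AnnularDiagramGroup {X : Type*} (P : SemigroupPresentation X) (u : List X) : Type _ :=
  Quotient (AnnularDiagram.setoid P u u)

/-- The product nests one annular diagram in another. -/
instance {X : Type*} (P : SemigroupPresentation X) (u : List X) :
    Group (AnnularDiagramGroup P u) where
  mul := Quotient.map₂ AnnularDiagram.comp fun _ _ h _ _ h' => .comp_congr h h'
  one := Quotient.mk _ (.nil u)
  inv := Quotient.map AnnularDiagram.reverse fun _ _ h => h.reverse
  mul_assoc := by
    rintro ⟨a⟩ ⟨b⟩ ⟨c⟩
    exact Quotient.sound (.assoc a b c)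
  one_mul := by
    rintro ⟨a⟩
    exact Quotient.sound (.nil_comp a)
  mul_one := by
    rintro ⟨a⟩
    exact Quotient.sound (.comp_nil a)
  inv_mul_cancel := by
    rintro ⟨a⟩
    exact Quotient.sound a.reverse_comp

/-- The presentation read off from the core: the letters are the vertices of the core, and each
caret with root `x`, left child `y` and right child `z` gives the relation `x = y z`. -/
def corePresentation (G : Set ThompsonT) : SemigroupPresentation (CoreVertex G) where
  rels := {e | ∃ x y z, CoreEdge G false x y ∧ CoreEdge G true x z ∧ e = ([x], [y, z])}
  ne_nil := by
    rintro _ ⟨x, y, z, -, -, rfl⟩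
    simp

end StallingsCore

/-! Both groups are realized by homeomorphisms of the circle, and the two images coincide. Let every
letter of a word be an interval of length one, so that a circle with label `u` is `[0, |u|)`. A cell
stretches its outer path linearly onto its inner path, and a change of the distinguished vertex
exchanges two intervals. This map (`eval`) respects dipoles and all other moves, so a diagram from
the root letter to itself acts on `ℝ/ℤ`.

The action is faithful. The first folding rule of the core makes the presentation deterministic:
each letter `x` has at most one relation `x = y z`. Any two expansions of a word (sequences of
replacements of `x` by `y z`) therefore have a common expansion, and every diagram is an expansion,
a rotation and an inverse expansion (`exists_normal_form`). An expansion is recovered from its map,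
because replaced letters get length at least two while surviving letters keep length one. Hence a
diagram with trivial map is trivial (`eq_nil_of_eval_eq_id`).

The image is the set of accepted elements. An expansion of the root letter is a binary tree whose
leaves are labeled by the vertices of the core at the ends of the corresponding paths
(`exists_expansion_of_tree`, `exists_tree_of_expansion`). A normal form is thus a pair of trees with
a cyclic matching of leaves that respects labels, which is a tree diagram mapping to the core.
Acceptance concerns the reduced diagram; removing a pair of identified carets keeps the labels
consistent because, by the second folding rule, a caret of the core is determined by its children
(`exists_isReduced`). Nesting corresponds to composition in the opposite order, so the isomorphism
inverts. -/

namespace StallingsCore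

/-! ### The groupoid of annular diagrams -/

/-- Annular diagrams up to equivalence. -/
def DiagramClass {X : Type*} (P : SemigroupPresentation X) (u v : List X) : Type _ :=
  Quotient (AnnularDiagram.setoid P u v)

namespace DiagramClass

variable {X : Type*} {P : SemigroupPresentation X}

/-- The class of the annulus of width zero. -/
def nil (u : List X) : DiagramClass P u u := Quotient.mk _ (.nil u)

/-- The class of an annular diagram with one cell. -/
def cell {u v : List X} (p q : List X) {r s : List X} (h : P.IsCell r s)
    (hu : u = p ++ r ++ q) (hv : v = p ++ s ++ q) : DiagramClass P u v :=
  Quotient.mk _ (.cell p q h hu hv)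

/-- The class of a change of the distinguished vertex. -/
def shift {u v : List X} (p q : List X) (hu : u = p ++ q) (hv : v = q ++ p) :
    DiagramClass P u v :=
  Quotient.mk _ (.shift p q hu hv)

/-- Nesting of diagrams. -/
def comp {u v w : List X} : DiagramClass P u v → DiagramClass P v w → DiagramClass P u w :=
  Quotient.map₂ AnnularDiagram.comp fun _ _ h _ _ h' => .comp_congr h h'

/-- The class of the diagram turned inside out. -/
def inv {u v : List X} : DiagramClass P u v → DiagramClass P v u :=
  Quotient.map AnnularDiagram.reverse fun _ _ h => h.reverse

infixr:80 " ⊚ " => DiagramClass.comp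

variable {u v w z : List X}

theorem comp_assoc (a : DiagramClass P u v) (b : DiagramClass P v w) (c : DiagramClass P w z) :
    (a ⊚ b) ⊚ c = a ⊚ (b ⊚ c) := by
  rcases a with ⟨a⟩; rcases b with ⟨b⟩; rcases c with ⟨c⟩
  exact Quotient.sound (.assoc a b c)

theorem nil_comp (a : DiagramClass P u v) : nil u ⊚ a = a := by
  rcases a with ⟨a⟩
  exact Quotient.sound (.nil_comp a)

theorem comp_nil (a : DiagramClass P u v) : a ⊚ nil v = a := by
  rcases a with ⟨a⟩
  exact Quotient.sound (.comp_nil a)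

theorem comp_inv (a : DiagramClass P u v) : a ⊚ a.inv = nil u := by
  rcases a with ⟨a⟩
  exact Quotient.sound a.comp_reverse

theorem inv_comp (a : DiagramClass P u v) : a.inv ⊚ a = nil v := by
  rcases a with ⟨a⟩
  exact Quotient.sound a.reverse_comp

theorem inv_comp_cancel (a : DiagramClass P u v) (b : DiagramClass P v w) :
    a.inv ⊚ a ⊚ b = b := by
  rw [← comp_assoc, inv_comp, nil_comp]

theorem comp_inv_rev (a : DiagramClass P u v) (b : DiagramClass P v w) :
    (a ⊚ b).inv = b.inv ⊚ a.inv := by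
  rcases a with ⟨a⟩; rcases b with ⟨b⟩
  rfl

theorem inv_nil : (nil u : DiagramClass P u u).inv = nil u := rfl

theorem inv_shift (p q : List X) (hu : u = p ++ q) (hv : v = q ++ p) :
    (shift p q hu hv : DiagramClass P u v).inv = shift q p hv hu := rfl

theorem shift_nil_right (p : List X) (hu : u = p ++ []) (hv : u = [] ++ p) :
    (shift p [] hu hv : DiagramClass P u u) = nil u :=
  Quotient.sound (.shift_full p hu hv)

theorem shift_nil_left (p : List X) (hu : u = [] ++ p) (hv : u = p ++ []) :
    (shift [] p hu hv : DiagramClass P u u) = nil u := by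
  rw [← inv_shift p [] hv hu, shift_nil_right, inv_nil]

theorem shift_shift_of_prefix (p q t : List X) (h₁ : u = p ++ (q ++ t))
    (h₂ : v = (q ++ t) ++ p) (h₃ : v = q ++ (t ++ p)) (h₄ : w = (t ++ p) ++ q)
    (h₅ : u = (p ++ q) ++ t) (h₆ : w = t ++ (p ++ q)) :
    (shift p (q ++ t) h₁ h₂ ⊚ shift q (t ++ p) h₃ h₄ : DiagramClass P u w) =
      shift (p ++ q) t h₅ h₆ :=
  Quotient.sound (.shift_shift p q t h₁ h₂ h₃ h₄ h₅ h₆)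

/-- Two successive changes of the distinguished vertex amount to one. -/
theorem exists_shift_comp_shift (p q p' q' : List X) (hu : u = p ++ q) (hv : v = q ++ p)
    (hv' : v = p' ++ q') (hw : w = q' ++ p') :
    ∃ (p₁ q₁ : List X) (h₁ : u = p₁ ++ q₁) (h₂ : w = q₁ ++ p₁),
      (shift p q hu hv ⊚ shift p' q' hv' hw : DiagramClass P u w) = shift p₁ q₁ h₁ h₂ := by
  rcases List.append_eq_append_iff.1 (hv.symm.trans hv') with ⟨m, rfl, rfl⟩ | ⟨t, rfl, rfl⟩
  · -- the second vertex lies beyond the first circle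
    refine ⟨m, q' ++ q, by simp [hu], by simp [hw], ?_⟩
    -- Here `u = m q' q` and the second move wraps around, so the total displacement is `m`. The
    -- first shift is split as a shift along `m` and one along `q'`; the latter is inverse to the
    -- second shift.
    have e := shift_shift_of_prefix (P := P) (u := u) (v := w) (w := v) m q' q
      (by simp [hu]) (by simp [hw]) hw hv' hu hv
    rw [← e, comp_assoc, ← inv_shift (q ++ m) q' hv' hw, inv_comp, comp_nil]
  · exact ⟨p ++ p', t, by simp [hu], by simp [hw],
      shift_shift_of_prefix p p' t hu hv hv' hw (by simp [hu]) (by simp [hw])⟩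

theorem shift_comp_cell (p q t : List X) {r s : List X} {v' : List X} (h : P.IsCell r s)
    (h₁ : u = (p ++ r ++ q) ++ t) (h₂ : v = t ++ (p ++ r ++ q))
    (h₃ : v = (t ++ p) ++ r ++ q) (h₄ : w = (t ++ p) ++ s ++ q)
    (h₅ : u = p ++ r ++ (q ++ t)) (h₆ : v' = p ++ s ++ (q ++ t))
    (h₇ : v' = (p ++ s ++ q) ++ t) (h₈ : w = t ++ (p ++ s ++ q)) :
    (shift (p ++ r ++ q) t h₁ h₂ ⊚ cell (t ++ p) q h h₃ h₄ : DiagramClass P u w) =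
      cell p (q ++ t) h h₅ h₆ ⊚ shift (p ++ s ++ q) t h₇ h₈ :=
  Quotient.sound (.shift_cell p q t h h₁ h₂ h₃ h₄ h₅ h₆ h₇ h₈)

/-- This is `shift_comp_cell` with both shifts moved to the other side by inverting them: the cell
now lies in the arc that the shift brings to the front. -/
theorem shift_comp_cell' (p q t : List X) {r s : List X} {v' : List X} (h : P.IsCell r s)
    (h₁ : u = t ++ (p ++ r ++ q)) (h₂ : v = (p ++ r ++ q) ++ t)
    (h₃ : v = p ++ r ++ (q ++ t)) (h₄ : w = p ++ s ++ (q ++ t))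
    (h₅ : u = (t ++ p) ++ r ++ q) (h₆ : v' = (t ++ p) ++ s ++ q)
    (h₇ : v' = t ++ (p ++ s ++ q)) (h₈ : w = (p ++ s ++ q) ++ t) :
    (shift t (p ++ r ++ q) h₁ h₂ ⊚ cell p (q ++ t) h h₃ h₄ : DiagramClass P u w) =
      cell (t ++ p) q h h₅ h₆ ⊚ shift t (p ++ s ++ q) h₇ h₈ := by
  have e := shift_comp_cell p q t h h₂ h₁ h₅ h₆ h₃ h₄ h₈ h₇
  rw [← inv_shift (p ++ r ++ q) t h₂ h₁, ← inv_shift (p ++ s ++ q) t h₈ h₇,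
    ← inv_comp_cancel (shift (p ++ r ++ q) t h₂ h₁) (cell (t ++ p) q h h₅ h₆), e]
  simp only [comp_assoc, comp_inv, comp_nil]

theorem cell_comp_cell (p m q : List X) {r s r' s' : List X} {v' : List X}
    (h : P.IsCell r s) (h' : P.IsCell r' s')
    (h₁ : u = p ++ r ++ (m ++ r' ++ q)) (h₂ : v = p ++ s ++ (m ++ r' ++ q))
    (h₃ : v = (p ++ s ++ m) ++ r' ++ q) (h₄ : w = (p ++ s ++ m) ++ s' ++ q)
    (h₅ : u = (p ++ r ++ m) ++ r' ++ q) (h₆ : v' = (p ++ r ++ m) ++ s' ++ q)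
    (h₇ : v' = p ++ r ++ (m ++ s' ++ q)) (h₈ : w = p ++ s ++ (m ++ s' ++ q)) :
    (cell p (m ++ r' ++ q) h h₁ h₂ ⊚ cell (p ++ s ++ m) q h' h₃ h₄ : DiagramClass P u w) =
      cell (p ++ r ++ m) q h' h₅ h₆ ⊚ cell p (m ++ s' ++ q) h h₇ h₈ :=
  Quotient.sound (.disjoint p m q h h' h₁ h₂ h₃ h₄ h₅ h₆ h₇ h₈)

@[elab_as_elim]
theorem induction {motive : ∀ {u v : List X}, DiagramClass P u v → Prop}
    (nil : ∀ u, motive (nil u))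
    (cell : ∀ {u v : List X} (p q : List X) {r s : List X} (h : P.IsCell r s)
      (hu : u = p ++ r ++ q) (hv : v = p ++ s ++ q), motive (cell p q h hu hv))
    (shift : ∀ {u v : List X} (p q : List X) (hu : u = p ++ q) (hv : v = q ++ p),
      motive (shift p q hu hv))
    (comp : ∀ {u v w : List X} (a : DiagramClass P u v) (b : DiagramClass P v w),
      motive a → motive b → motive (a ⊚ b))
    (d : DiagramClass P u v) : motive d := by
  induction d using Quotient.inductionOn with | _ d =>
    induction d with
    | nil u => exact nil u
    | cell p q h hu hv => exact cell p q h hu hv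
    | shift p q hu hv => exact shift p q hu hv
    | comp a b iha ihb => exact comp _ _ iha ihb

end DiagramClass

/-! ### Annular diagrams as piecewise linear maps -/

/-- The map that stretches `[i, i + a)` linearly onto `[i, i + b)` and translates what lies
to the right of it. -/
noncomputable def cellMap (i a b t : ℝ) : ℝ :=
  if t < i then t else if t < i + a then i + (t - i) * (b / a) else t + (b - a)

/-- The map that exchanges the intervals `[0, a)` and `[a, a + b)`. -/
noncomputable def rotMap (a b t : ℝ) : ℝ :=
  if t < 0 then t else if t < a then t + b else if t < a + b then t - a else t

theorem stretch_nonneg {a b x : ℝ} (ha : 0 < a) (hb : 0 < b) (h : 0 ≤ x) : 0 ≤ x * (b / a) := by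
  positivity

theorem stretch_lt {a b x : ℝ} (ha : 0 < a) (hb : 0 < b) (h : x < a) : x * (b / a) < b := by
  rw [← mul_div_assoc, div_lt_iff₀ ha]
  nlinarith

/-- Removal of a dipole, at the level of maps. -/
theorem cellMap_cellMap {i a b : ℝ} (ha : 0 < a) (hb : 0 < b) (t : ℝ) :
    cellMap i b a (cellMap i a b t) = t := by
  rcases lt_or_ge t i with h | h
  · simp [cellMap, h]
  rcases lt_or_ge t (i + a) with h' | h'
  · have h1 := stretch_nonneg ha hb (sub_nonneg.2 h)
    have h2 := stretch_lt ha hb (sub_lt_iff_lt_add'.2 h')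
    simp only [cellMap, not_lt.2 h, h', if_false, if_true]
    rw [if_neg (by linarith), if_pos (by linarith)]
    field_simp
    ring
  · simp only [cellMap, not_lt.2 h, not_lt.2 h', if_false]
    rw [if_neg (by linarith), if_neg (by linarith)]
    ring

/-- Commutation of disjoint cells. Performing the left cell first displaces the right one by `s -
r`. -/
theorem cellMap_comm {i j r s r' s' : ℝ} (hr : 0 < r) (hs : 0 < s) (hr' : 0 < r')
    (hs' : 0 < s') (hij : i + r ≤ j) (t : ℝ) :
    cellMap (j + (s - r)) r' s' (cellMap i r s t) = cellMap i r s (cellMap j r' s' t) := by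
  rcases lt_or_ge t i with h | h
  · rw [cellMap.eq_def i r s t, cellMap.eq_def j r' s' t, if_pos h, if_pos (by linarith), cellMap,
      cellMap, if_pos (by linarith), if_pos h]
  rcases lt_or_ge t (i + r) with h' | h'
  · have h1 := stretch_nonneg hr hs (sub_nonneg.2 h)
    have h2 := stretch_lt hr hs (sub_lt_iff_lt_add'.2 h')
    rw [cellMap.eq_def j r' s' t, if_pos (by linarith), cellMap.eq_def i r s t,
      if_neg (by linarith), if_pos h', cellMap, if_pos (by linarith)]
  rw [cellMap.eq_def i r s t, if_neg (by linarith), if_neg (by linarith)]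
  rcases lt_or_ge t j with h1 | h1
  · rw [cellMap.eq_def j r' s' t, if_pos h1, cellMap.eq_def i r s t, if_neg (by linarith),
      if_neg (by linarith), cellMap, if_pos (by linarith)]
  rcases lt_or_ge t (j + r') with h2 | h2
  · have h3 := stretch_nonneg hr' hs' (sub_nonneg.2 h1)
    rw [cellMap.eq_def j r' s' t, if_neg (by linarith), if_pos h2, cellMap, if_neg (by linarith),
      if_pos (by linarith), cellMap, if_neg (by linarith), if_neg (by linarith)]
    ring
  · rw [cellMap.eq_def j r' s' t, if_neg (by linarith), if_neg (by linarith), cellMap,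
      if_neg (by linarith), if_neg (by linarith), cellMap, if_neg (by linarith),
      if_neg (by linarith)]
    ring

theorem rotMap_rotMap {p q t : ℝ} (hp : 0 ≤ p) (hq : 0 ≤ q) (ht : 0 ≤ t) (x : ℝ) :
    rotMap q (t + p) (rotMap p (q + t) x) = rotMap (p + q) t x := by
  unfold rotMap
  split_ifs <;> linarith

/-- Independence of a cell from the distinguished vertex: a rotation past the arc that contains the
cell translates that cell by `t`. -/
theorem cellMap_rotMap {p r s q t : ℝ} (hp : 0 ≤ p) (hr : 0 < r) (hs : 0 < s) (hq : 0 ≤ q)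
    (ht : 0 ≤ t) (x : ℝ) :
    cellMap (t + p) r s (rotMap (p + r + q) t x) = rotMap (p + s + q) t (cellMap p r s x) := by
  rcases lt_or_ge x p with h | h
  · rw [cellMap.eq_def p r s x, if_pos h]
    unfold rotMap cellMap
    split_ifs <;> linarith
  rcases lt_or_ge x (p + r) with h' | h'
  · have h1 := stretch_nonneg hr hs (sub_nonneg.2 h)
    have h2 := stretch_lt hr hs (sub_lt_iff_lt_add'.2 h')
    rw [cellMap.eq_def p r s x, if_neg (by linarith), if_pos h', rotMap, if_neg (by linarith),
      if_pos (by linarith), rotMap, if_neg (by linarith), if_pos (by linarith), cellMap,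
      if_neg (by linarith), if_pos (by linarith)]
    ring
  · rw [cellMap.eq_def p r s x, if_neg (by linarith), if_neg (by linarith)]
    unfold rotMap cellMap
    split_ifs <;> linarith

theorem SemigroupPresentation.IsCell.length_pos {X : Type*} {P : SemigroupPresentation X}
    {r s : List X} (h : P.IsCell r s) : (0 : ℝ) < r.length ∧ (0 : ℝ) < s.length := by
  have : r ≠ [] ∧ s ≠ [] := h.elim (P.ne_nil _) fun h => (P.ne_nil _ h).symm
  exact_mod_cast this.imp List.length_pos_iff.2 List.length_pos_iff.2

namespace AnnularDiagram

variable {X : Type*} {P : SemigroupPresentation X}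

/-- The piecewise linear map of an annular diagram. The circle with label `u` is the interval
`[0, |u|)`, its letters being intervals of length one; a cell maps its outer path linearly onto
its inner path. -/
noncomputable def eval : ∀ {u v : List X}, AnnularDiagram P u v → ℝ → ℝ
  | _, _, nil _ => id
  | _, _, cell (r := r) (s := s) p _ _ _ _ => cellMap p.length r.length s.length
  | _, _, shift p q _ _ => rotMap p.length q.length
  | _, _, comp a b => b.eval ∘ a.eval

theorem Equivalent.eval_eq {u v : List X} {a b : AnnularDiagram P u v} (h : Equivalent a b) :
    a.eval = b.eval := by
  induction h with
  | refl => rfl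
  | symm _ ih => exact ih.symm
  | trans _ _ ih ih' => exact ih.trans ih'
  | comp_congr _ _ ih ih' => simp only [eval, ih, ih']
  | nil_comp | comp_nil | assoc => rfl
  | shift_full p =>
    ext x
    simp only [eval, rotMap, List.length_nil, Nat.cast_zero, add_zero, id]
    split_ifs <;> rfl
  | shift_shift p q t =>
    ext x
    simp only [eval, Function.comp, List.length_append, Nat.cast_add]
    exact rotMap_rotMap (by positivity) (by positivity) (by positivity) x
  | shift_cell p q t h =>
    ext x
    simp only [eval, Function.comp, List.length_append, Nat.cast_add]
    exact cellMap_rotMap (by positivity) h.length_pos.1 h.length_pos.2 (by positivity)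
      (by positivity) x
  | @disjoint u v v' w p m q r s r' s' h h' =>
    ext x
    simp only [eval, Function.comp, List.length_append, Nat.cast_add]
    rw [← cellMap_comm h.length_pos.1 h.length_pos.2 h'.length_pos.1 h'.length_pos.2
      (by linarith [show (0 : ℝ) ≤ m.length by positivity])]
    congr 1
    ring
  | dipole p q h =>
    ext x
    exact cellMap_cellMap h.length_pos.1 h.length_pos.2 x

/-- The map of a diagram maps `[0, |u|)` into `[0, |v|)`, fixes the negative numbers and
translates the numbers from `|u|` on. -/
theorem eval_range {u v : List X} (a : AnnularDiagram P u v) (t : ℝ) :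
    (t < 0 → a.eval t = t) ∧
      (0 ≤ t → t < u.length → 0 ≤ a.eval t ∧ a.eval t < v.length) ∧
      ((u.length : ℝ) ≤ t → a.eval t = t + (v.length - u.length)) := by
  induction a generalizing t with
  | nil u => simp +contextual [eval]
  | @cell u v p q r s h hu hv =>
    obtain ⟨hr, hs⟩ := h.length_pos
    have hp : (0 : ℝ) ≤ p.length := by positivity
    have hq : (0 : ℝ) ≤ q.length := by positivity
    simp only [eval, hu, hv, List.length_append, Nat.cast_add, cellMap]
    refine ⟨fun h => if_pos (by linarith), fun h1 h2 => ?_, fun h => ?_⟩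
    · split_ifs with h3 h4
      · constructor <;> linarith
      · have h5 := stretch_nonneg hr hs (sub_nonneg.2 (not_lt.1 h3))
        have h6 := stretch_lt hr hs (sub_lt_iff_lt_add'.2 h4)
        constructor <;> linarith
      · constructor <;> linarith
    · rw [if_neg (by linarith), if_neg (by linarith)]
      ring
  | shift p q hu hv =>
    have hp : (0 : ℝ) ≤ p.length := by positivity
    have hq : (0 : ℝ) ≤ q.length := by positivity
    simp only [eval, hu, hv, List.length_append, Nat.cast_add, rotMap]
    refine ⟨fun h => if_pos h, fun h1 h2 => ?_, fun h => ?_⟩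
    · split_ifs <;> constructor <;> linarith
    · split_ifs <;> linarith
  | comp a b iha ihb =>
    obtain ⟨a1, a2, a3⟩ := iha t
    obtain ⟨b1, b2, b3⟩ := ihb (a.eval t)
    simp only [eval, Function.comp]
    refine ⟨fun h => ?_, fun h1 h2 => b2 (a2 h1 h2).1 (a2 h1 h2).2, fun h => ?_⟩
    · rw [a1 h] at b1 ⊢
      exact b1 h
    · rw [a3 h] at b3 ⊢
      rw [b3 (by linarith)]
      ring

end AnnularDiagram

namespace DiagramClass

variable {X : Type*} {P : SemigroupPresentation X} {u v w : List X}

/-- The piecewise linear map of a class of annular diagrams. -/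
noncomputable def eval : DiagramClass P u v → ℝ → ℝ :=
  Quotient.lift AnnularDiagram.eval fun _ _ h => h.eval_eq

theorem eval_nil : (nil u : DiagramClass P u u).eval = id := rfl

theorem eval_cell (p q : List X) {r s : List X} (h : P.IsCell r s)
    (hu : u = p ++ r ++ q) (hv : v = p ++ s ++ q) :
    (cell p q h hu hv : DiagramClass P u v).eval = cellMap p.length r.length s.length := rfl

theorem eval_shift (p q : List X) (hu : u = p ++ q) (hv : v = q ++ p) :
    (shift p q hu hv : DiagramClass P u v).eval = rotMap p.length q.length := rfl

theorem eval_comp (a : DiagramClass P u v) (b : DiagramClass P v w) :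
    (a ⊚ b).eval = b.eval ∘ a.eval := by
  rcases a with ⟨a⟩; rcases b with ⟨b⟩
  rfl

theorem eval_comp_apply (a : DiagramClass P u v) (b : DiagramClass P v w) (t : ℝ) :
    (a ⊚ b).eval t = b.eval (a.eval t) := by
  rw [eval_comp, Function.comp]

theorem eval_inv_eval (a : DiagramClass P u v) (t : ℝ) : a.inv.eval (a.eval t) = t := by
  change (a.inv.eval ∘ a.eval) t = t
  rw [← eval_comp, comp_inv, eval_nil, id]

theorem eval_eval_inv (a : DiagramClass P u v) (t : ℝ) : a.eval (a.inv.eval t) = t := by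
  change (a.eval ∘ a.inv.eval) t = t
  rw [← eval_comp, inv_comp, eval_nil, id]

theorem eval_range (a : DiagramClass P u v) (t : ℝ) :
    (t < 0 → a.eval t = t) ∧
      (0 ≤ t → t < u.length → 0 ≤ a.eval t ∧ a.eval t < v.length) ∧
      ((u.length : ℝ) ≤ t → a.eval t = t + (v.length - u.length)) :=
  Quotient.inductionOn a fun a => a.eval_range t

end DiagramClass

/-! ### Expansions and normal forms -/

/-- All relations have the form `x = y z`, with at most one relation for every letter `x`. -/
structure SemigroupPresentation.IsBinary {X : Type*} (P : SemigroupPresentation X) : Prop where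
  shape : ∀ e ∈ P.rels, ∃ x y z, e = ([x], [y, z])
  det : ∀ {x s s'}, ([x], s) ∈ P.rels → ([x], s') ∈ P.rels → s = s'

theorem SemigroupPresentation.IsCell.of_mem {X : Type*} {P : SemigroupPresentation X}
    {r s : List X} (h : (r, s) ∈ P.rels) : P.IsCell r s :=
  .inl h

/-- Sequences of replacements of a letter `x` by `y z`, for relations `x = y z`. -/
inductive Expansion {X : Type*} (P : SemigroupPresentation X) : List X → List X → Type _
  | nil (u : List X) : Expansion P u u
  | step {u v w : List X} (p q : List X) {x y z : X} (h : ([x], [y, z]) ∈ P.rels)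
      (hu : u = p ++ [x] ++ q) (hv : v = p ++ [y, z] ++ q) (e : Expansion P v w) :
      Expansion P u w

theorem cellMap_of_le {i a b t : ℝ} (ha : 0 < a) (h : t ≤ i) : cellMap i a b t = t := by
  rcases h.lt_or_eq with h | rfl
  · exact if_pos h
  · simp [cellMap, ha]

theorem cellMap_of_ge {i a b t : ℝ} (ha : 0 < a) (h : i + a ≤ t) :
    cellMap i a b t = t + (b - a) := by
  rw [cellMap, if_neg (by linarith), if_neg (by linarith)]

/-- A replacement of one letter by two has slopes 1 and 2 only, so it never shrinks distances. -/
theorem sub_le_cellMap_sub (i : ℝ) {s t : ℝ} (h : s ≤ t) :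
    t - s ≤ cellMap i 1 2 t - cellMap i 1 2 s := by
  unfold cellMap
  split_ifs <;> linarith

/-- Two marked letters of one word are the same occurrence or lie at disjoint positions, in one of
two orders. This reduces the interaction of two replacements to determinism or to commutation of
cells. -/
theorem append_singleton_append_eq_iff {X : Type*} {p q p' q' : List X} {x x' : X}
    (h : p ++ [x] ++ q = p' ++ [x'] ++ q') :
    (p = p' ∧ x = x' ∧ q = q') ∨ (∃ m, p' = p ++ [x] ++ m ∧ q = m ++ [x'] ++ q') ∨
      ∃ m, p = p' ++ [x'] ++ m ∧ q' = m ++ [x] ++ q := by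
  simp only [List.append_assoc, List.singleton_append] at h
  rcases List.append_eq_append_iff.1 h with ⟨a, rfl, ha⟩ | ⟨a, rfl, ha⟩
  · cases a with
    | nil => simp_all
    | cons b m => exact .inr (.inl ⟨m, by simp_all⟩)
  · cases a with
    | nil => simp_all
    | cons b m => exact .inr (.inr ⟨m, by simp_all⟩)

namespace Expansion

open DiagramClass

variable {X : Type*} {P : SemigroupPresentation X}

/-- The annular diagram of an expansion. -/
def toClass : ∀ {u w : List X}, Expansion P u w → DiagramClass P u w
  | _, _, nil u => .nil u
  | _, _, step p q h hu hv e => cell p q (.of_mem h) hu hv ⊚ e.toClass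

/-- Concatenation of expansions. -/
def append : ∀ {u v w : List X}, Expansion P u v → Expansion P v w → Expansion P u w
  | _, _, _, nil _, f => f
  | _, _, _, step p q h hu hv e, f => step p q h hu hv (e.append f)

variable {u v w : List X}

theorem toClass_append (e : Expansion P u v) (f : Expansion P v w) :
    (e.append f).toClass = e.toClass ⊚ f.toClass := by
  induction e with
  | nil => exact (nil_comp _).symm
  | step p q h hu hv e ih => simp only [append, toClass, ih, comp_assoc]

theorem eval_step (p q : List X) {x y z : X} (h : ([x], [y, z]) ∈ P.rels)
    (hu : u = p ++ [x] ++ q) (hv : v = p ++ [y, z] ++ q) (e : Expansion P v w) (t : ℝ) :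
    (step p q h hu hv e).toClass.eval t = e.toClass.eval (cellMap p.length 1 2 t) := by
  rw [toClass, eval_comp_apply, eval_cell]
  simp

theorem sub_le_eval_sub (e : Expansion P u w) {s t : ℝ} (h : s ≤ t) :
    t - s ≤ e.toClass.eval t - e.toClass.eval s := by
  induction e generalizing s t with
  | nil => exact le_rfl
  | step p q _ _ _ e ih =>
    have h1 := sub_le_cellMap_sub p.length h
    rw [eval_step, eval_step]
    exact h1.trans (ih (by linarith))

theorem strictMono_eval (e : Expansion P u w) : StrictMono e.toClass.eval := fun s t h => by
  linarith [e.sub_le_eval_sub h.le]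

/-- A monotone surjection of the line has no jumps; surjectivity comes from the inverse diagram. -/
theorem continuous_eval (e : Expansion P u w) : Continuous e.toClass.eval :=
  e.strictMono_eval.monotone.continuous_of_surjective fun t => ⟨_, eval_eval_inv _ t⟩

theorem continuous_eval_inv (e : Expansion P u w) : Continuous e.toClass.inv.eval := by
  refine Monotone.continuous_of_surjective (fun s t h => ?_) fun t => ⟨_, eval_inv_eval _ t⟩
  rwa [← e.strictMono_eval.le_iff_le, eval_eval_inv, eval_eval_inv]

theorem eval_zero (e : Expansion P u w) : e.toClass.eval 0 = 0 := by
  induction e with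
  | nil => rfl
  | step p q _ _ _ e ih => rwa [eval_step, cellMap_of_le one_pos (by positivity)]

theorem eval_length (e : Expansion P u w) : e.toClass.eval u.length = w.length := by
  rw [((eval_range _ _).2.2 le_rfl)]
  ring

/-- The first replacement gives the letter length 2, and later ones do not shrink it. This is how
the map reveals which letters were expanded. -/
theorem two_le_eval_step (p q : List X) {x y z : X} (h : ([x], [y, z]) ∈ P.rels)
    (hu : u = p ++ [x] ++ q) (hv : v = p ++ [y, z] ++ q) (e : Expansion P v w) :
    2 ≤ (step p q h hu hv e).toClass.eval (p.length + 1) -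
      (step p q h hu hv e).toClass.eval p.length := by
  rw [eval_step, eval_step, cellMap_of_le one_pos le_rfl, cellMap_of_ge one_pos le_rfl]
  refine le_trans ?_ (e.sub_le_eval_sub ?_) <;> linarith

/-- A letter that can be expanded is either expanded in a given expansion, and this can be done
first, or it survives, and can be expanded afterwards. -/
theorem expand_first_or_last (hP : P.IsBinary) (e : Expansion P u w) (p q : List X) {x y z : X}
    (h : ([x], [y, z]) ∈ P.rels) (hu : u = p ++ [x] ++ q) (hv : v = p ++ [y, z] ++ q) :
    (∃ e' : Expansion P v w, e.toClass = cell p q (.of_mem h) hu hv ⊚ e'.toClass) ∨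
      ∃ (p' q' w' : List X) (hw : w = p' ++ [x] ++ q') (hw' : w' = p' ++ [y, z] ++ q')
        (e' : Expansion P v w'),
        e.toClass ⊚ cell p' q' (.of_mem h) hw hw' = cell p q (.of_mem h) hu hv ⊚ e'.toClass ∧
          e.toClass.eval (p.length + 1) = e.toClass.eval p.length + 1 := by
  induction e generalizing p q v with
  | nil u =>
    refine .inr ⟨p, q, v, hu, hv, nil v, ?_, rfl⟩
    simp only [toClass, nil_comp, comp_nil]
  | @step u v₁ w p₁ q₁ x₁ y₁ z₁ h₁ hu₁ hv₁ e ih =>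
    -- The first replacement of the given expansion is at the chosen letter, to its right, or to its
    -- left. In the first case `det` makes the two relations equal; in the others the cells are
    -- disjoint, so the chosen one can be moved past it.
    rcases append_singleton_append_eq_iff (hu.symm.trans hu₁) with
      ⟨rfl, rfl, rfl⟩ | ⟨m, rfl, rfl⟩ | ⟨m, rfl, rfl⟩
    · obtain ⟨rfl, rfl⟩ : y = y₁ ∧ z = z₁ := by simpa using hP.det h h₁
      subst hv hv₁
      exact .inl ⟨e, rfl⟩
    · have key := cell_comp_cell (P := P) (u := u) (v := v) (v' := v₁)
        (w := p ++ [y, z] ++ (m ++ [y₁, z₁] ++ q₁)) p m q₁ (.of_mem h) (.of_mem h₁)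
        hu hv (by simp [hv]) (by simp) hu₁ hv₁ (by simp [hv₁]) rfl
      have hlen : (p.length : ℝ) + 1 ≤ (p ++ [x] ++ m).length := by simp
      rcases ih p (m ++ [y₁, z₁] ++ q₁) (by simp [hv₁]) rfl with
        ⟨e', he⟩ | ⟨p', q', w', hw, hw', e', he, hev⟩
      · refine .inl ⟨step (p ++ [y, z] ++ m) q₁ h₁ (by simp [hv]) (by simp) e', ?_⟩
        simp only [toClass]
        rw [he, ← comp_assoc, ← comp_assoc, key]
      · refine .inr ⟨p', q', w', hw, hw',
          step (p ++ [y, z] ++ m) q₁ h₁ (by simp [hv]) (by simp) e', ?_, ?_⟩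
        · simp only [toClass]
          rw [comp_assoc, he, ← comp_assoc, ← comp_assoc, key]
        · rw [eval_step, eval_step, cellMap_of_le one_pos hlen,
            cellMap_of_le one_pos (by linarith), hev]
    · have key := cell_comp_cell (P := P) (u := u) (v := v₁) (v' := v)
        (w := (p₁ ++ [y₁, z₁] ++ m) ++ [y, z] ++ q) p₁ m q (.of_mem h₁) (.of_mem h)
        hu₁ hv₁ (by simp [hv₁]) rfl hu hv (by simp [hv]) (by simp)
      have hlen : ((p₁ ++ [x₁] ++ m).length : ℝ) = p₁.length + 1 + m.length := by
        push_cast [List.length_append, List.length_singleton]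
        ring
      have hlen' : ((p₁ ++ [y₁, z₁] ++ m).length : ℝ) = p₁.length + 2 + m.length := by
        push_cast [List.length_append, List.length_cons, List.length_nil]
        ring
      have hm : (0 : ℝ) ≤ m.length := by positivity
      rcases ih (p₁ ++ [y₁, z₁] ++ m) q (by simp [hv₁]) rfl with
        ⟨e', he⟩ | ⟨p', q', w', hw, hw', e', he, hev⟩
      · refine .inl ⟨step p₁ (m ++ [y, z] ++ q) h₁ (by simp [hv]) (by simp) e', ?_⟩
        simp only [toClass]
        rw [he, ← comp_assoc, ← comp_assoc, key]
      · refine .inr ⟨p', q', w', hw, hw',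
          step p₁ (m ++ [y, z] ++ q) h₁ (by simp [hv]) (by simp) e', ?_, ?_⟩
        · simp only [toClass]
          rw [comp_assoc, he, ← comp_assoc, ← comp_assoc, key]
        · rw [hlen'] at hev
          rw [eval_step, eval_step, hlen, cellMap_of_ge one_pos (by linarith),
            cellMap_of_ge one_pos (by linarith)]
          convert hev using 2 <;> ring_nf

/-- An expansion is determined by its piecewise linear map. -/
theorem toClass_heq_of_eval_eq (hP : P.IsBinary) {w' : List X} (e : Expansion P u w)
    (f : Expansion P u w') (h : e.toClass.eval = f.toClass.eval) :
    w = w' ∧ e.toClass ≍ f.toClass := by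
  induction e with
  | nil u =>
    cases f with
    | nil => exact ⟨rfl, .rfl⟩
    | step p q hr hu hv f =>
      have := two_le_eval_step p q hr hu hv f
      rw [← h] at this
      norm_num [toClass, eval_nil] at this
  | step p q hr hu hv e ih =>
    rcases expand_first_or_last hP f p q hr hu hv with
      ⟨f', hf⟩ | ⟨p', q', w'', hw, hw', f', -, hev⟩
    · obtain ⟨rfl, he⟩ := ih f' (by
        ext t
        have := congrFun h ((cell p q (.of_mem hr) hu hv : DiagramClass P _ _).inv.eval t)
        rwa [hf, toClass, eval_comp, eval_comp, Function.comp, Function.comp,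
          eval_eval_inv] at this)
      rw [hf, toClass, eq_of_heq he]
      exact ⟨rfl, .rfl⟩
    -- The letter would survive with length 1 on one side while being stretched to length at least 2
    -- on the other.
    · have := two_le_eval_step p q hr hu hv e
      rw [h, hev] at this
      linarith

/-- Two expansions of a word have a common expansion. -/
theorem exists_common_expansion (hP : P.IsBinary) {v' : List X} (e : Expansion P u v)
    (f : Expansion P u v') :
    ∃ (w : List X) (e' : Expansion P v w) (f' : Expansion P v' w),
      e.toClass ⊚ e'.toClass = f.toClass ⊚ f'.toClass := by
  induction e generalizing v' with
  | nil => exact ⟨v', f, nil v', by simp only [toClass, nil_comp, comp_nil]⟩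
  | step p q h hu hv e ih =>
    rcases expand_first_or_last hP f p q h hu hv with
      ⟨f', hf⟩ | ⟨p', q', w, hw, hw', f', hf, -⟩
    · obtain ⟨w, a, b, hab⟩ := ih f'
      exact ⟨w, a, b, by simp only [hf, toClass, comp_assoc, hab]⟩
    · obtain ⟨w, a, b, hab⟩ := ih f'
      -- The letter survives in the target of `f`, so its replacement is appended there, before the
      -- rest of the common expansion.
      refine ⟨w, a, step p' q' h hw hw' b, ?_⟩
      simp only [toClass]
      rw [comp_assoc, hab, ← comp_assoc, ← hf, comp_assoc]

/-- Expanding after a change of the distinguished vertex can be done before it. -/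
theorem exists_shift_comp (e : Expansion P v w) (p q : List X) (hu : u = p ++ q)
    (hv : v = q ++ p) :
    ∃ (u' : List X) (e' : Expansion P u u') (p' q' : List X) (h₁ : u' = p' ++ q')
      (h₂ : w = q' ++ p'),
      shift p q hu hv ⊚ e.toClass = e'.toClass ⊚ shift p' q' h₁ h₂ := by
  induction e generalizing u p q with
  | nil => exact ⟨u, nil u, p, q, hu, hv, by simp only [toClass, nil_comp, comp_nil]⟩
  | @step v v₁ w a b x y z h ha hb e ih =>
    -- The letter to be replaced in `v = q p` lies either in `q` or in `p`; in both cases it can be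
    -- replaced at its place in `u = p q` first.
    have hab : (∃ m, q = a ++ [x] ++ m ∧ b = m ++ p) ∨ ∃ m, a = q ++ m ∧ p = m ++ [x] ++ b := by
      have h' := ha.symm.trans hv
      simp only [List.append_assoc, List.singleton_append] at h'
      rcases List.append_eq_append_iff.1 h' with ⟨m, rfl, hm⟩ | ⟨m, rfl, hm⟩
      · cases m with
        | nil => exact .inr ⟨[], by simp_all⟩
        | cons c m => exact .inl ⟨m, by simp_all⟩
      · exact .inr ⟨m, by simp_all⟩
    rcases hab with ⟨m, rfl, rfl⟩ | ⟨m, rfl, rfl⟩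
    · obtain ⟨u', e', p', q', h₁, h₂, he⟩ :=
        ih (u := p ++ (a ++ [y, z] ++ m)) p (a ++ [y, z] ++ m) rfl (by simp [hb])
      refine ⟨u', step (p ++ a) m h (by simp [hu]) (by simp) e', p', q', h₁, h₂, ?_⟩
      simp only [toClass]
      rw [comp_assoc, ← he, ← comp_assoc, ← comp_assoc, shift_comp_cell' a m p (.of_mem h)]
    · obtain ⟨u', e', p', q', h₁, h₂, he⟩ :=
        ih (u := (m ++ [y, z] ++ b) ++ q) (m ++ [y, z] ++ b) q rfl (by simp [hb])
      refine ⟨u', step m (b ++ q) h (by simp [hu]) (by simp) e', p', q', h₁, h₂, ?_⟩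
      simp only [toClass]
      rw [comp_assoc, ← he, ← comp_assoc, ← comp_assoc, shift_comp_cell m b q (.of_mem h)]

end Expansion

/-! ### Normal forms and faithfulness of the action -/

namespace DiagramClass

variable {X : Type*} {P : SemigroupPresentation X} {u v : List X}

/-- Every annular diagram is an expansion, followed by a change of the distinguished vertex,
followed by an inverse expansion. -/
theorem exists_normal_form (hP : P.IsBinary) (d : DiagramClass P u v) :
    ∃ (u' v' : List X) (e : Expansion P u u') (f : Expansion P v v') (p q : List X)
      (h₁ : u' = p ++ q) (h₂ : v' = q ++ p),
      d = e.toClass ⊚ shift p q h₁ h₂ ⊚ f.toClass.inv := by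
  induction d using DiagramClass.induction with
  | nil u =>
    refine ⟨u, u, .nil u, .nil u, u, [], by simp, by simp, ?_⟩
    rw [shift_nil_right, nil_comp, Expansion.toClass, nil_comp, inv_nil]
  | @cell u v p q r s h hu hv =>
    have hs : ∀ w : List X, shift w [] (by simp) (by simp) = (nil w : DiagramClass P w w) :=
      fun w => shift_nil_right w _ _
    rcases h with h | h
    · obtain ⟨x, y, z, hxyz⟩ := hP.shape _ h
      obtain ⟨rfl, rfl⟩ := Prod.mk.inj hxyz
      refine ⟨v, v, .step p q h hu hv (.nil v), .nil v, v, [], by simp, by simp, ?_⟩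
      rw [hs, nil_comp, Expansion.toClass, Expansion.toClass, Expansion.toClass, inv_nil,
        comp_nil, comp_nil]
    · obtain ⟨x, y, z, hxyz⟩ := hP.shape _ h
      obtain ⟨rfl, rfl⟩ := Prod.mk.inj hxyz
      refine ⟨u, u, .nil u, .step p q h hv hu (.nil u), u, [], by simp, by simp, ?_⟩
      rw [hs, nil_comp, Expansion.toClass, Expansion.toClass, Expansion.toClass, comp_nil,
        nil_comp]
      rfl
  | @shift u v p q hu hv =>
    refine ⟨u, v, .nil u, .nil v, p, q, hu, hv, ?_⟩
    rw [Expansion.toClass, Expansion.toClass, inv_nil, comp_nil, nil_comp]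
  | comp a b iha ihb =>
    obtain ⟨u₁, v₁, e, f, p, q, h₁, h₂, ha⟩ := iha
    obtain ⟨u₂, v₂, e', f', p', q', h₁', h₂', hb⟩ := ihb
    -- In the middle of the product stands `f⁻¹ e'`, where `f` and `e'` expand the same word. A
    -- common expansion turns it into `k l⁻¹`; then `k` is moved outward across the first rotation,
    -- `l⁻¹` inward across the second, and the two rotations merge.
    obtain ⟨w, k, l, hkl⟩ := f.exists_common_expansion hP e'
    obtain ⟨u₃, k', p₃, q₃, h₃, h₃', hk⟩ := k.exists_shift_comp p q h₁ h₂
    obtain ⟨u₄, l', p₄, q₄, h₄, h₄', hl⟩ := l.exists_shift_comp q' p' h₂' h₁'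
    obtain ⟨p₅, q₅, h₅, h₅', hs⟩ :=
      exists_shift_comp_shift (P := P) p₃ q₃ q₄ p₄ h₃ h₃' h₄' h₄
    refine ⟨u₃, u₄, e.append k', f'.append l', p₅, q₅, h₅, h₅', ?_⟩
    have hkl' : f.toClass.inv ⊚ e'.toClass = k.toClass ⊚ l.toClass.inv := by
      rw [← inv_comp_cancel f.toClass (k.toClass ⊚ l.toClass.inv), ← comp_assoc f.toClass, hkl,
        comp_assoc, comp_inv, comp_nil]
    have hl' : l.toClass.inv ⊚ shift p' q' h₁' h₂' = shift q₄ p₄ h₄' h₄ ⊚ l'.toClass.inv := by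
      simpa only [comp_inv_rev, inv_shift] using congrArg inv hl
    rw [Expansion.toClass_append, Expansion.toClass_append, comp_inv_rev, ← hs, ha, hb]
    simp only [comp_assoc]
    rw [← comp_assoc k'.toClass, ← hk, ← comp_assoc f.toClass.inv, hkl']
    simp only [comp_assoc]
    rw [← comp_assoc l.toClass.inv, hl']
    simp only [comp_assoc]

/-- The piecewise linear map of an annular diagram determines it. -/
theorem eq_nil_of_eval_eq_id (hP : P.IsBinary) (d : DiagramClass P u u) (h : d.eval = id) :
    d = nil u := by
  obtain ⟨u', v', e, f, p, q, h₁, h₂, rfl⟩ := exists_normal_form hP d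
  have hef : f.toClass.eval = rotMap p.length q.length ∘ e.toClass.eval := by
    ext t
    have := congrArg f.toClass.eval (congrFun h t)
    rwa [eval_comp_apply, eval_comp_apply, eval_eval_inv, eval_shift, id, eq_comm] at this
  -- Expansions fix 0, whereas a rotation with both arcs nonempty sends 0 to `|q|`.
  have h0 : p = [] ∨ q = [] := by
    have := congrFun hef 0
    rw [Function.comp, e.eval_zero, f.eval_zero] at this
    by_contra! hpq
    have hp : (0 : ℝ) < p.length := by exact_mod_cast List.length_pos_iff.2 hpq.1
    have hq : (0 : ℝ) < q.length := by exact_mod_cast List.length_pos_iff.2 hpq.2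
    rw [rotMap, if_neg (by linarith), if_pos hp] at this
    linarith
  -- The rotation is trivial, but the words `u'` and `v'` are only propositionally equal, so
  -- composition with it is a transport.
  have hs : ∃ h : v' = u', ∀ w (c : DiagramClass P v' w),
      shift p q h₁ h₂ ⊚ c = h ▸ c := by
    rcases h0 with rfl | rfl
    · obtain rfl : v' = u' := by simp [h₁, h₂]
      exact ⟨rfl, fun w c => by rw [shift_nil_left, nil_comp]⟩
    · obtain rfl : v' = u' := by simp [h₁, h₂]
      exact ⟨rfl, fun w c => by rw [shift_nil_right, nil_comp]⟩
  obtain ⟨rfl, hs⟩ := hs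
  have hr : rotMap p.length q.length = id := by
    rw [← eval_shift (P := P) p q h₁ h₂, ← comp_nil (shift p q h₁ h₂), hs, eval_nil]
  obtain ⟨-, he⟩ := e.toClass_heq_of_eval_eq hP f (by rw [hef, hr]; rfl)
  rw [hs, eq_of_heq he, comp_inv]

end DiagramClass

/-! ### Trees -/

/-- The point of the dyadic interval of a vertex that divides it in the ratio `s : 1 - s`. -/
noncomputable def leafPoint (w : List Bool) (s : ℝ) : ℝ := leftEnd w + s * intervalLength w

theorem leafPoint_nil (s : ℝ) : leafPoint [] s = s := by
  simp [leafPoint, leftEnd, intervalLength]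

theorem leafPoint_cons (b : Bool) (w : List Bool) (s : ℝ) :
    leafPoint (b :: w) s = ((if b then 1 else 0) + leafPoint w s) / 2 := by
  simp only [leafPoint, leftEnd, intervalLength, List.length_cons, pow_succ]
  ring

theorem leafPoint_append (u v : List Bool) (s : ℝ) :
    leafPoint (u ++ v) s = leafPoint u (leafPoint v s) := by
  induction u with
  | nil => rw [leafPoint_nil, List.nil_append]
  | cons b u ih => rw [List.cons_append, leafPoint_cons, leafPoint_cons, ih]

theorem leafPoint_append_singleton (u : List Bool) (b : Bool) (s : ℝ) :
    leafPoint (u ++ [b]) s = leafPoint u (((if b then 1 else 0) + s) / 2) := by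
  rw [leafPoint_append, leafPoint_cons, leafPoint_nil]

theorem leafPoint_mem (w : List Bool) {s : ℝ} (hs : s ∈ Set.Ico (0 : ℝ) 1) :
    leafPoint w s ∈ Set.Ico (0 : ℝ) 1 := by
  induction w with
  | nil => rwa [leafPoint_nil]
  | cons b w ih =>
    obtain ⟨h0, h1⟩ := ih
    rw [leafPoint_cons]
    constructor <;> split_ifs <;> linarith

namespace FullTree

theorem leaves_length_pos (T : FullTree) : 0 < T.leaves.length := by
  induction T with
  | leaf => simp [leaves]
  | caret l r ihl _ => simp only [leaves, List.length_append, List.length_map]; omega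

theorem nil_mem_vertices (T : FullTree) : [] ∈ T.vertices := by
  cases T <;> simp [vertices]

/-- The vertices of a tree are the beginnings of its leaves. -/
theorem mem_vertices_iff (T : FullTree) (w : List Bool) :
    w ∈ T.vertices ↔ ∃ w', w ++ w' ∈ T.leaves := by
  induction T generalizing w with
  | leaf => simp [vertices, leaves]
  | caret l r ihl ihr =>
    cases w with
    | nil =>
      obtain ⟨u, hu⟩ := List.exists_mem_of_length_pos (caret l r).leaves_length_pos
      exact ⟨fun _ => ⟨u, hu⟩, fun _ => nil_mem_vertices _⟩
    | cons b w => cases b <;> simp [vertices, leaves, ihl, ihr]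

theorem vertices_of_append (T : FullTree) {u v : List Bool} (h : u ++ v ∈ T.vertices) :
    u ∈ T.vertices := by
  rw [mem_vertices_iff] at h ⊢
  obtain ⟨w, hw⟩ := h
  exact ⟨v ++ w, by rwa [← List.append_assoc]⟩

theorem sibling_mem_vertices (T : FullTree) {w : List Bool} {b : Bool}
    (h : w ++ [b] ∈ T.vertices) (b' : Bool) : w ++ [b'] ∈ T.vertices := by
  induction T generalizing w with
  | leaf => simp [vertices] at h
  | caret l r ihl ihr =>
    cases w with
    | nil => cases b' <;> simp [vertices, nil_mem_vertices]
    | cons c w =>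
      cases c
      · have h' : w ++ [b] ∈ l.vertices := by simpa [vertices] using h
        simpa [vertices] using ihl h'
      · have h' : w ++ [b] ∈ r.vertices := by simpa [vertices] using h
        simpa [vertices] using ihr h'

theorem leaves_nodup (T : FullTree) : T.leaves.Nodup := by
  induction T with
  | leaf => simp [leaves]
  | caret l r ihl ihr =>
    refine List.nodup_append.2 ⟨ihl.map (List.cons_injective), ihr.map (List.cons_injective), ?_⟩
    intro a ha b hb
    obtain ⟨a', -, rfl⟩ := List.mem_map.1 ha
    obtain ⟨b', -, rfl⟩ := List.mem_map.1 hb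
    simp

/-- The dyadic intervals of the leaves cover `[0, 1)`. -/
theorem exists_leafPoint_eq (T : FullTree) {t : ℝ} (ht : t ∈ Set.Ico (0 : ℝ) 1) :
    ∃ u ∈ T.leaves, ∃ s ∈ Set.Ico (0 : ℝ) 1, leafPoint u s = t := by
  induction T generalizing t with
  | leaf => exact ⟨[], by simp [leaves], t, ht, leafPoint_nil t⟩
  | caret l r ihl ihr =>
    rcases lt_or_ge t (1 / 2) with h | h
    · obtain ⟨u, hu, s, hs, hus⟩ := ihl (t := 2 * t) ⟨by linarith [ht.1], by linarith⟩
      exact ⟨false :: u, by simp [leaves, hu], s, hs, by simp [leafPoint_cons, hus]⟩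
    · obtain ⟨u, hu, s, hs, hus⟩ := ihr (t := 2 * t - 1) ⟨by linarith, by linarith [ht.2]⟩
      exact ⟨true :: u, by simp [leaves, hu], s, hs, by simp [leafPoint_cons, hus]⟩

/-- A caret can be attached to any leaf. -/
theorem exists_attach (T : FullTree) {A B : List (List Bool)} {u : List Bool}
    (h : T.leaves = A ++ [u] ++ B) :
    ∃ T' : FullTree, T'.leaves = A ++ [u ++ [false], u ++ [true]] ++ B := by
  induction T generalizing A B u with
  | leaf =>
    obtain ⟨rfl, rfl, rfl⟩ : A = [] ∧ u = [] ∧ B = [] := by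
      cases A <;> simp_all [leaves]
    exact ⟨caret leaf leaf, by simp [leaves]⟩
  | caret l r ihl ihr =>
    simp only [leaves, List.append_assoc, List.singleton_append] at h
    rcases List.append_eq_append_iff.1 h with ⟨C, rfl, hC⟩ | ⟨C, hC, hB⟩
    · obtain ⟨A', D, hr, rfl, hD⟩ := List.map_eq_append_iff.1 hC
      obtain ⟨u', B', rfl, rfl, rfl⟩ := List.map_eq_cons_iff.1 hD
      obtain ⟨r', hr'⟩ := ihr (A := A') (B := B') (u := u') (by simp [hr])
      exact ⟨caret l r', by simp [leaves, hr']⟩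
    · cases C with
      | nil =>
        obtain ⟨u', B', hr, rfl, rfl⟩ := List.map_eq_cons_iff.1 hB.symm
        obtain ⟨r', hr'⟩ := ihr (A := []) (B := B') (u := u') (by simp [hr])
        rw [List.append_nil] at hC
        subst hC
        exact ⟨caret l r', by simp [leaves, hr']⟩
      | cons c C =>
        obtain ⟨rfl, rfl⟩ := List.cons.inj hB
        obtain ⟨A', D, hl, rfl, hD⟩ := List.map_eq_append_iff.1 hC
        obtain ⟨u', B', rfl, rfl, rfl⟩ := List.map_eq_cons_iff.1 hD
        obtain ⟨l', hl'⟩ := ihl (A := A') (B := B') (u := u') (by simp [hl])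
        exact ⟨caret l' r, by simp [leaves, hl']⟩

theorem eq_leaf_of_nil_mem_leaves {T : FullTree} (h : [] ∈ T.leaves) : T = leaf := by
  cases T with
  | leaf => rfl
  | caret l r => simp [leaves] at h

/-- A caret of leaves can be removed. -/
theorem exists_detach (T : FullTree) {u : List Bool} (h₀ : u ++ [false] ∈ T.leaves)
    (h₁ : u ++ [true] ∈ T.leaves) :
    ∃ (T' : FullTree) (A B : List (List Bool)),
      T.leaves = A ++ (u ++ [false]) :: (u ++ [true]) :: B ∧ T'.leaves = A ++ u :: B := by
  induction T generalizing u with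
  | leaf => simp [leaves] at h₀
  | caret l r ihl ihr =>
    cases u with
    | nil =>
      obtain rfl := eq_leaf_of_nil_mem_leaves (T := l) (by simpa [leaves] using h₀)
      obtain rfl := eq_leaf_of_nil_mem_leaves (T := r) (by simpa [leaves] using h₁)
      exact ⟨leaf, [], [], by simp [leaves], by simp [leaves]⟩
    | cons b u =>
      cases b
      · obtain ⟨T', A, B, h, h'⟩ := ihl (u := u) (by simpa [leaves] using h₀)
          (by simpa [leaves] using h₁)
        exact ⟨caret T' r, A.map (List.cons false),
          B.map (List.cons false) ++ r.leaves.map (List.cons true), by simp [leaves, h],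
          by simp [leaves, h']⟩
      · obtain ⟨T', A, B, h, h'⟩ := ihr (u := u) (by simpa [leaves] using h₀)
          (by simpa [leaves] using h₁)
        exact ⟨caret l T', l.leaves.map (List.cons false) ++ A.map (List.cons true),
          B.map (List.cons true), by simp [leaves, h], by simp [leaves, h']⟩

end FullTree

/-! ### Expansions of a letter and trees -/

/-- Following the path `w` from the letter `x`, where a relation `x = y z` makes `y` the left and
`z` the right child of `x`, one arrives at the given letter. -/
inductive Reach {X : Type*} (P : SemigroupPresentation X) : X → List Bool → X → Prop
  | nil (x : X) : Reach P x [] x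
  | cons {x y z t : X} (b : Bool) {w : List Bool} (h : ([x], [y, z]) ∈ P.rels)
      (ht : Reach P (if b then z else y) w t) : Reach P x (b :: w) t

/-- `F` maps the dyadic intervals of the leaves of `T`, in their order, linearly onto
`[0, 1)`, `[1, 2)`, and so on. -/
def IsChart (T : FullTree) (F : ℝ → ℝ) : Prop :=
  ∀ (j : ℕ) (u : List Bool), T.leaves[j]? = some u → ∀ s ∈ Set.Ico (0 : ℝ) 1,
    F (leafPoint u s) = j + s

section

variable {X : Type*} {P : SemigroupPresentation X}

theorem reach_nil_iff {x y : X} : Reach P x [] y ↔ x = y :=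
  ⟨fun h => by cases h; rfl, fun h => h ▸ .nil x⟩

theorem Reach.append {x y z : X} {u v : List Bool} (h : Reach P x u y) (h' : Reach P y v z) :
    Reach P x (u ++ v) z := by
  induction h with
  | nil => exact h'
  | cons b h _ ih => exact .cons b h (ih h')

theorem reach_append_iff {x z : X} {u v : List Bool} :
    Reach P x (u ++ v) z ↔ ∃ y, Reach P x u y ∧ Reach P y v z := by
  refine ⟨fun h => ?_, fun ⟨y, h, h'⟩ => h.append h'⟩
  induction u generalizing x with
  | nil => exact ⟨x, .nil x, h⟩
  | cons b u ih =>
    cases h with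
    | cons _ h ht =>
      obtain ⟨y, h1, h2⟩ := ih ht
      exact ⟨y, .cons b h h1, h2⟩

theorem Reach.unique (hP : P.IsBinary) {x y y' : X} {u : List Bool} (h : Reach P x u y)
    (h' : Reach P x u y') : y = y' := by
  induction h with
  | nil => exact reach_nil_iff.1 h'
  | cons b h _ ih =>
    cases h' with
    | cons _ h1 ht =>
      obtain ⟨rfl, rfl⟩ : _ ∧ _ := by simpa using hP.det h h1
      exact ih ht

theorem reach_cons_iff (hP : P.IsBinary) {x y z t : X} (h : ([x], [y, z]) ∈ P.rels) (b : Bool)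
    {w : List Bool} : Reach P x (b :: w) t ↔ Reach P (if b then z else y) w t := by
  refine ⟨fun h' => ?_, fun h' => .cons b h h'⟩
  cases h' with
  | cons _ h1 ht =>
    obtain ⟨rfl, rfl⟩ : _ ∧ _ := by simpa using hP.det h h1
    exact ht

theorem forall₂_append_right {α β : Type*} {R : α → β → Prop} {l : List α} {l₁ l₂ : List β}
    (h : List.Forall₂ R l (l₁ ++ l₂)) :
    ∃ m₁ m₂, l = m₁ ++ m₂ ∧ List.Forall₂ R m₁ l₁ ∧ List.Forall₂ R m₂ l₂ :=
  ⟨_, _, (List.take_append_drop l₁.length l).symm, List.forall₂_take_append _ _ _ h,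
    List.forall₂_drop_append _ _ _ h⟩

theorem forall₂_append_left {α β : Type*} {R : α → β → Prop} {l₁ l₂ : List α} {l : List β}
    (h : List.Forall₂ R (l₁ ++ l₂) l) :
    ∃ m₁ m₂, l = m₁ ++ m₂ ∧ List.Forall₂ R l₁ m₁ ∧ List.Forall₂ R l₂ m₂ := by
  obtain ⟨m₁, m₂, h₀, h₁, h₂⟩ := forall₂_append_right h.flip
  exact ⟨m₁, m₂, h₀, h₁.flip, h₂.flip⟩

/-- A tree, all of whose leaves can be reached from `x`, gives an expansion of `x`. -/
theorem exists_expansion_of_tree (hP : P.IsBinary) (T : FullTree) {x : X} {m : List X}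
    (hT : List.Forall₂ (Reach P x) T.leaves m) (p q : List X) {u w : List X}
    (hu : u = p ++ [x] ++ q) (hw : w = p ++ m ++ q) :
    ∃ e : Expansion P u w, (∀ t ≤ (p.length : ℝ), e.toClass.eval t = t) ∧
      (∀ t ≥ (p.length : ℝ) + 1, e.toClass.eval t = t + (m.length - 1)) ∧
      IsChart T fun t => e.toClass.eval (p.length + t) - p.length := by
  -- The letter is expanded inside a context `p`, `q`. The behavior of the map outside `[|p|, |p| +
  -- 1]` is carried along because the two subtrees are expanded one after the other, and each must
  -- only translate the part belonging to the other.
  induction T generalizing x m p q u w with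
  | leaf =>
    obtain ⟨y, n, hy, hn, rfl⟩ := List.forall₂_cons_left_iff.1 hT
    obtain rfl := List.forall₂_nil_left_iff.1 hn
    obtain rfl := reach_nil_iff.1 hy
    obtain rfl := hu.trans hw.symm
    refine ⟨.nil u, fun _ _ => rfl, fun t _ => by simp [Expansion.toClass, DiagramClass.eval_nil],
      fun j u hj s _ => ?_⟩
    cases j with
    | zero =>
      obtain rfl : [] = u := by simpa [FullTree.leaves] using hj
      simp [Expansion.toClass, DiagramClass.eval_nil, leafPoint_nil]
    | succ j => simp [FullTree.leaves] at hj
  | caret l r ihl ihr =>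
    obtain ⟨y, z, hxyz⟩ : ∃ y z, ([x], [y, z]) ∈ P.rels := by
      obtain ⟨v, vs, hv⟩ := List.exists_cons_of_length_pos l.leaves_length_pos
      rw [FullTree.leaves, hv, List.map_cons, List.cons_append] at hT
      obtain ⟨_, _, ht, -, -⟩ := List.forall₂_cons_left_iff.1 hT
      cases ht with
      | cons _ h _ => exact ⟨_, _, h⟩
    obtain ⟨m₁, m₂, rfl, h₁, h₂⟩ := forall₂_append_left hT
    replace h₁ : List.Forall₂ (Reach P y) l.leaves m₁ :=
      (List.forall₂_map_left_iff.1 h₁).imp fun _ _ h => by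
        simpa using (reach_cons_iff hP hxyz false).1 h
    replace h₂ : List.Forall₂ (Reach P z) r.leaves m₂ :=
      (List.forall₂_map_left_iff.1 h₂).imp fun _ _ h => by
        simpa using (reach_cons_iff hP hxyz true).1 h
    obtain ⟨e₁, hl₁, hr₁, hc₁⟩ := ihl h₁ p ([z] ++ q) (u := p ++ [y, z] ++ q) (by simp) rfl
    -- When the right child is expanded, the left one has already become `m₁`, which joins the left
    -- context.
    obtain ⟨e₂, hl₂, hr₂, hc₂⟩ := ihr h₂ (p ++ m₁) q (u := p ++ m₁ ++ ([z] ++ q)) (w := w)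
      (by simp) (by simp [hw])
    have hm₁ : (0 : ℝ) < m₁.length := by
      rw [← h₁.length_eq]
      exact_mod_cast l.leaves_length_pos
    rw [List.length_append, Nat.cast_add] at hl₂ hr₂
    have heval : ∀ t, (Expansion.step p q hxyz hu rfl (e₁.append e₂)).toClass.eval t =
        e₂.toClass.eval (e₁.toClass.eval (cellMap p.length 1 2 t)) := fun t => by
      rw [Expansion.eval_step, Expansion.toClass_append, DiagramClass.eval_comp_apply]
    refine ⟨.step p q hxyz hu rfl (e₁.append e₂), fun t ht => ?_, fun t ht => ?_, ?_⟩
    · rw [heval, cellMap_of_le one_pos ht, hl₁ t ht, hl₂ t (by linarith)]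
    · rw [heval, cellMap_of_ge one_pos ht, hr₁ _ (by linarith), hr₂ _ (by linarith)]
      push_cast [List.length_append]
      ring
    · intro j u hj s hs
      simp only [heval]
      rw [FullTree.leaves, List.getElem?_append] at hj
      split_ifs at hj with hlt
      · rw [List.length_map] at hlt
        obtain ⟨v, hv, rfl⟩ : ∃ v, l.leaves[j]? = some v ∧ false :: v = u := by simpa using hj
        have hp := leafPoint_mem v hs
        have hc := hc₁ j v hv s hs
        have hj' : (j : ℝ) + 1 ≤ m₁.length := by
          rw [← h₁.length_eq]
          exact_mod_cast hlt
        have : cellMap p.length 1 2 (p.length + leafPoint (false :: v) s) =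
            p.length + leafPoint v s := by
          rw [leafPoint_cons, cellMap, if_neg (by simp; linarith [hp.1]),
            if_pos (by simp; linarith [hp.2])]
          simp
        rw [this, hl₂]
        · exact hc
        · linarith [hs.2]
      · rw [List.length_map] at hj hlt
        obtain ⟨v, hv, rfl⟩ : ∃ v, r.leaves[j - l.leaves.length]? = some v ∧ true :: v = u := by
          simpa using hj
        have hp := leafPoint_mem v hs
        have hc := hc₂ _ v hv s hs
        have : cellMap p.length 1 2 (p.length + leafPoint (true :: v) s) =
            p.length + 1 + leafPoint v s := by
          rw [leafPoint_cons]
          unfold cellMap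
          simp only [if_true]
          split_ifs <;> linarith [hp.1, hp.2]
        rw [Nat.cast_sub (not_lt.1 hlt), h₁.length_eq, List.length_append, Nat.cast_add] at hc
        rw [this, hr₁ _ (by linarith [hp.1])]
        have h' : (p.length : ℝ) + 1 + leafPoint v s + (m₁.length - 1) =
          p.length + m₁.length + leafPoint v s := by ring
        rw [h']
        linarith

/-- An expansion of a word that labels the leaves of a tree enlarges the tree. -/
theorem exists_tree_of_expansion {x : X} {u w : List X} (e : Expansion P u w) (T : FullTree)
    (hT : List.Forall₂ (Reach P x) T.leaves u) (F : ℝ → ℝ) (hF : IsChart T F) :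
    ∃ T' : FullTree, List.Forall₂ (Reach P x) T'.leaves w ∧ IsChart T' (e.toClass.eval ∘ F) := by
  induction e generalizing T F with
  | nil => exact ⟨T, hT, hF⟩
  | step p q h hu hv e ih =>
    rename_i u v w a b c
    rw [hu] at hT
    obtain ⟨A', B, hleaves, hA', hB⟩ := forall₂_append_right hT
    obtain ⟨A, C, rfl, hA, hC⟩ := forall₂_append_right hA'
    obtain ⟨n, C', hn, hC', rfl⟩ := List.forall₂_cons_right_iff.1 hC
    obtain rfl := List.forall₂_nil_right_iff.1 hC'
    obtain ⟨T', hT'⟩ := T.exists_attach hleaves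
    have hlen : A.length = p.length := hA.length_eq
    have hf : List.Forall₂ (Reach P x) T'.leaves v := by
      rw [hT', hv]
      refine List.rel_append (List.rel_append hA ?_) hB
      exact .cons (Reach.append hn (.cons false h (.nil _)))
        (.cons (Reach.append hn (.cons true h (.nil _))) .nil)
    obtain ⟨T'', h₁, h₂⟩ := ih T' hf (cellMap p.length 1 2 ∘ F) (by
      intro j l hj s hs
      rw [Function.comp]
      rw [hT', List.append_assoc, List.getElem?_append] at hj
      split_ifs at hj with hlt
      · have hj' : (j : ℝ) + 1 ≤ p.length := by
          rw [hlen] at hlt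
          exact_mod_cast hlt
        rw [hF j l (by rw [hleaves, List.append_assoc, List.getElem?_append_left hlt, hj]) s hs,
          cellMap_of_le one_pos (by linarith [hs.2])]
      · have hroot : T.leaves[p.length]? = some n := by simp [hleaves, ← hlen]
        obtain ⟨i, rfl⟩ := Nat.exists_eq_add_of_le (not_lt.1 hlt)
        rw [hlen] at hj ⊢
        rw [Nat.add_sub_cancel_left] at hj
        have hs' := hs
        obtain ⟨hs0, hs1⟩ := hs
        -- The new leaves at positions `|p|` and `|p| + 1` are the halves of the old leaf at `|p|`,
        -- whose unit interval is stretched to length 2. Each later leaf was one position earlier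
        -- and is translated by 1.
        rcases i with _ | _ | i
        · obtain rfl : n ++ [false] = l := by simpa using hj
          rw [leafPoint_append_singleton, hF _ _ hroot]
          · unfold cellMap
            simp only [Bool.false_eq_true, if_false, zero_add]
            split_ifs <;> push_cast <;> linarith
          · constructor <;> simp <;> linarith
        · obtain rfl : n ++ [true] = l := by simpa using hj
          rw [leafPoint_append_singleton, hF _ _ hroot]
          · unfold cellMap
            simp only [if_true]
            split_ifs <;> push_cast <;> linarith
          · constructor <;> simp <;> linarith
        · have hl : T.leaves[p.length + 1 + i]? = some l := by
            have hB' : B[i]? = some l := by simpa using hj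
            rw [hleaves, List.getElem?_append_right (by simp [hlen])]
            simpa [hlen] using hB'
          rw [hF _ _ hl s hs']
          push_cast
          rw [cellMap_of_ge one_pos (by linarith [show (0 : ℝ) ≤ i by positivity])]
          ring)
    refine ⟨T'', h₁, ?_⟩
    convert h₂ using 1
    ext t
    exact Expansion.eval_step p q h hu hv e _

end

open Set Filter Topology

/-! ### Dyadic piecewise linear maps given by tree diagrams -/

/-- A dyadic rational. -/
def IsDyadicReal (t : ℝ) : Prop := ∃ (k : ℤ) (n : ℕ), t = k / 2 ^ n

theorem isDyadicReal_intCast_add (m : ℤ) {t : ℝ} (h : IsDyadicReal t) : IsDyadicReal (m + t) := by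
  obtain ⟨k, n, rfl⟩ := h
  refine ⟨m * 2 ^ n + k, n, ?_⟩
  push_cast
  field_simp

theorem isDyadicReal_half_iff {t : ℝ} : IsDyadicReal (t / 2) ↔ IsDyadicReal t := by
  constructor
  · rintro ⟨k, n, h⟩
    exact ⟨2 * k, n, by push_cast; linear_combination 2 * h⟩
  · rintro ⟨k, n, rfl⟩
    exact ⟨k, n + 1, by rw [pow_succ, div_div]⟩

theorem coe_eq_coe_iff {s t : ℝ} :
    (s : UnitAddCircle) = (t : UnitAddCircle) ↔ ∃ m : ℤ, s = m + t := by
  rw [← sub_eq_zero, ← AddCircle.coe_sub, AddCircle.coe_eq_zero_iff]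
  refine exists_congr fun m => ?_
  rw [zsmul_one]
  constructor <;> intro h <;> linarith

theorem isDyadic_coe_iff {t : ℝ} : IsDyadic (t : UnitAddCircle) ↔ IsDyadicReal t := by
  constructor
  · rintro ⟨k, n, h⟩
    obtain ⟨m, rfl⟩ := coe_eq_coe_iff.1 h
    exact isDyadicReal_intCast_add m ⟨k, n, rfl⟩
  · rintro ⟨k, n, rfl⟩
    exact ⟨k, n, rfl⟩

theorem isDyadicReal_leafPoint_iff (w : List Bool) {s : ℝ} :
    IsDyadicReal (leafPoint w s) ↔ IsDyadicReal s := by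
  induction w with
  | nil => rw [leafPoint_nil]
  | cons b w ih =>
    rw [leafPoint_cons, isDyadicReal_half_iff, ← ih]
    cases b
    · simp
    · refine ⟨fun h => ?_, fun h => ?_⟩
      · have := isDyadicReal_intCast_add (-1) h
        simpa using this
      · have := isDyadicReal_intCast_add 1 h
        simpa using this

theorem intervalLength_pos (w : List Bool) : 0 < intervalLength w := by
  unfold intervalLength
  positivity

theorem leafPoint_add (w : List Bool) (s t : ℝ) :
    leafPoint w (s + t) = leafPoint w s + t * intervalLength w := by
  unfold leafPoint
  ring

namespace TreeDiagram

/-- The map of the circle sends the interval of each leaf of the input tree linearly onto that of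
the leaf of the output tree identified with it. -/
def Maps (D : TreeDiagram) (f : UnitAddCircle → UnitAddCircle) : Prop :=
  ∀ e ∈ D.leafPairs, ∀ s ∈ Ico (0 : ℝ) 1,
    f (leafPoint e.1 s : UnitAddCircle) = (leafPoint e.2 s : UnitAddCircle)

theorem exists_mem_leafPairs (D : TreeDiagram) {u : List Bool} (hu : u ∈ D.input.leaves) :
    ∃ v, (u, v) ∈ D.leafPairs := by
  have h : D.leafPairs.map Prod.fst = D.input.leaves :=
    List.map_fst_zip (by rw [List.length_rotate, D.same_leaves])
  rw [← h] at hu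
  obtain ⟨⟨u, v⟩, he, rfl⟩ := List.mem_map.1 hu
  exact ⟨v, he⟩

theorem exists_eq_leafPoint (D : TreeDiagram) (x : UnitAddCircle) :
    ∃ e ∈ D.leafPairs, ∃ s ∈ Ico (0 : ℝ) 1, x = (leafPoint e.1 s : UnitAddCircle) := by
  obtain ⟨t, ht, rfl⟩ := AddCircle.eq_coe_Ico x
  obtain ⟨u, hu, s, hs, rfl⟩ := D.input.exists_leafPoint_eq ht
  obtain ⟨v, hv⟩ := D.exists_mem_leafPairs hu
  exact ⟨(u, v), hv, s, hs, rfl⟩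

/-- A homeomorphism given by a tree diagram belongs to Thompson's group `T`. -/
theorem Maps.isDyadicPL {D : TreeDiagram} {f : UnitAddCircle ≃ₜ UnitAddCircle} (h : D.Maps f) :
    IsDyadicPL f := by
  refine ⟨fun x => ?_, (fun u => (leafPoint u 0 : UnitAddCircle)) '' {u | u ∈ D.input.leaves},
    D.input.leaves.finite_toSet.image _, ?_, fun x hx => ?_⟩
  · obtain ⟨e, he, s, hs, rfl⟩ := D.exists_eq_leafPoint x
    rw [h e he s hs, isDyadic_coe_iff, isDyadic_coe_iff, isDyadicReal_leafPoint_iff,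
      isDyadicReal_leafPoint_iff]
  · rintro _ ⟨u, -, rfl⟩
    exact isDyadic_coe_iff.2 ((isDyadicReal_leafPoint_iff u).2 ⟨0, 0, by simp⟩)
  · obtain ⟨e, he, s, hs, rfl⟩ := D.exists_eq_leafPoint x
    -- Only left endpoints can be breakpoints. At an interior point of a leaf interval the map is
    -- affine, with slope the ratio of the lengths of the two intervals.
    have hs0 : 0 < s := hs.1.lt_of_ne fun h0 =>
      hx ⟨e.1, (List.of_mem_zip he).1, by rw [h0]⟩
    refine ⟨(e.1.length : ℤ) - e.2.length, ?_⟩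
    have hc : Tendsto (fun t : ℝ => s + t / intervalLength e.1) (𝓝 0) (𝓝 s) := by
      have : Continuous fun t : ℝ => s + t / intervalLength e.1 := by fun_prop
      simpa using this.tendsto 0
    filter_upwards [hc.eventually (Ioo_mem_nhds hs0 hs.2)] with t ht
    have h1 : leafPoint e.1 s + t = leafPoint e.1 (s + t / intervalLength e.1) := by
      rw [leafPoint_add, div_mul_cancel₀ _ (intervalLength_pos _).ne']
    have h2 : t / intervalLength e.1 * intervalLength e.2 =
        (2 : ℝ) ^ ((e.1.length : ℤ) - e.2.length) * t := by
      rw [zpow_sub₀ two_ne_zero, zpow_natCast, zpow_natCast, intervalLength, intervalLength,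
        one_div, inv_pow, inv_pow]
      field_simp
    rw [← AddCircle.coe_add, h1, h e he _ (Ioo_subset_Ico_self ht), h e he s hs, leafPoint_add,
      AddCircle.coe_add, h2]

theorem Represents.maps {D : TreeDiagram} {f : ThompsonT} (h : D.Represents f) : D.Maps f.1 := h

/-- Charts of the two trees conjugate the map of the diagram to a rotation of the leaves. -/
theorem rotMap_chart (D : TreeDiagram) {F F' : ℝ → ℝ} (hF : IsChart D.input F)
    (hF' : IsChart D.output F') {a : ℕ} (ha : a + D.offset = D.output.leaves.length)
    {e : List Bool × List Bool} (he : e ∈ D.leafPairs) {s : ℝ} (hs : s ∈ Ico (0 : ℝ) 1) :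
    rotMap a D.offset (F (leafPoint e.1 s)) = F' (leafPoint e.2 s) := by
  obtain ⟨j, hj⟩ := List.mem_iff_getElem?.1 he
  obtain ⟨h1, h2⟩ := List.getElem?_zip_eq_some.1 hj
  have hjn : j < D.output.leaves.length := by
    rw [← D.same_leaves]
    exact (List.getElem?_eq_some_iff.1 h1).1
  rw [List.getElem?_rotate hjn] at h2
  rw [hF j _ h1 s hs, hF' _ _ h2 s hs]
  have hj0 : (0 : ℝ) ≤ j := by positivity
  rcases lt_or_ge j a with hja | hja
  · have : (j : ℝ) + 1 ≤ a := by exact_mod_cast hja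
    rw [Nat.mod_eq_of_lt (by omega), rotMap, if_neg (by linarith [hs.1]),
      if_pos (by linarith [hs.2])]
    push_cast
    ring
  · have h' : (j + D.offset) % D.output.leaves.length = j - a := by
      rw [← ha, show j + D.offset = (j - a) + (a + D.offset) by omega, Nat.add_mod_right,
        Nat.mod_eq_of_lt (by omega)]
    have h1 : (a : ℝ) ≤ j := by exact_mod_cast hja
    have h2 : (j : ℝ) + 1 ≤ a + D.offset := by
      rw [← ha] at hjn
      exact_mod_cast hjn
    rw [h', rotMap, if_neg (by linarith [hs.1]), if_neg (by linarith [hs.1]),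
      if_pos (by linarith [hs.2]), Nat.cast_sub hja]
    ring

/-- The two leaves of every pair can be reached from the letter `x` at a common letter. -/
def LabeledBy {X : Type*} (P : SemigroupPresentation X) (x : X) (D : TreeDiagram) : Prop :=
  ∀ e ∈ D.leafPairs, ∃ y, Reach P x e.1 y ∧ Reach P x e.2 y

/-- Removal of a pair of identified carets of leaves. -/
theorem exists_reduction (D : TreeDiagram) (hD : ¬ D.IsReduced) :
    ∃ (D' : TreeDiagram) (u v : List Bool),
      D'.input.leaves.length < D.input.leaves.length ∧
      (u ++ [false], v ++ [false]) ∈ D.leafPairs ∧ (u ++ [true], v ++ [true]) ∈ D.leafPairs ∧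
      ∀ e ∈ D'.leafPairs, e = (u, v) ∨ e ∈ D.leafPairs := by
  obtain ⟨u, v, h0, h1⟩ := not_not.1 hD
  have hu0 := List.of_mem_zip h0
  have hu1 := List.of_mem_zip h1
  obtain ⟨R', A, B, hA, hR'⟩ := D.input.exists_detach hu0.1 hu1.1
  obtain ⟨S', M, N, hM, hS'⟩ := D.output.exists_detach (List.mem_rotate.1 hu0.2)
    (List.mem_rotate.1 hu1.2)
  have hnodup : (D.output.leaves.rotate D.offset).Nodup :=
    List.nodup_rotate.2 D.output.leaves_nodup
  -- the positions of the two leaves in the rotated list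
  have hpos : ∀ (i : ℕ) (a b : List Bool), D.input.leaves[i]? = some a → (a, b) ∈ D.leafPairs →
      (D.output.leaves.rotate D.offset)[i]? = some b := by
    intro i a b hi hab
    obtain ⟨j, hj⟩ := List.mem_iff_getElem?.1 hab
    obtain ⟨hj1, hj2⟩ := List.getElem?_zip_eq_some.1 hj
    obtain rfl : i = j := (List.getElem?_inj (List.getElem?_eq_some_iff.1 hi).1
      D.input.leaves_nodup).1 (hi.trans hj1.symm)
    exact hj2
  have p0 := hpos A.length _ _ (by simp [hA]) h0
  have p1 := hpos (A.length + 1) _ _ (by simp [hA]) h1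
  -- The two sibling leaves stay adjacent after the rotation. The cut falls before or after the
  -- pair, and the offset drops by one in the latter case. A cut between them would put the right
  -- sibling at position 0, contrary to `p1`.
  obtain ⟨k, C, E, hk, hrot, hrot'⟩ : ∃ (k : ℕ) (C E : List (List Bool)), k < S'.leaves.length ∧
      D.output.leaves.rotate D.offset = C ++ (v ++ [false]) :: (v ++ [true]) :: E ∧
      S'.leaves.rotate k = C ++ v :: E := by
    have hsplit := List.take_append_drop D.offset D.output.leaves
    have hlen : (D.output.leaves.take D.offset).length = D.offset :=
      List.length_take_of_le D.offset_lt.le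
    have hne : D.output.leaves.drop D.offset ≠ [] := by
      rw [Ne, List.drop_eq_nil_iff]
      exact not_le.2 D.offset_lt
    have hrot : D.output.leaves.rotate D.offset =
        D.output.leaves.drop D.offset ++ D.output.leaves.take D.offset :=
      List.rotate_eq_drop_append_take D.offset_lt.le
    rw [hrot] at p0 p1 hnodup ⊢
    generalize D.output.leaves.take D.offset = U at *
    generalize D.output.leaves.drop D.offset = V at *
    rcases List.append_eq_append_iff.1 (hsplit.trans hM) with ⟨m, rfl, rfl⟩ | ⟨m, rfl, hm⟩
    · refine ⟨U.length, m, N ++ U, by simp [hS'], by simp, ?_⟩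
      rw [hS', List.append_assoc, List.rotate_append_length_eq]
      simp
    · rcases m with _ | ⟨c, _ | ⟨c', m⟩⟩
      · refine ⟨M.length, [], N ++ M, by simp [hS'], ?_, ?_⟩
        · rw [← show _ = V from hm]
          simp
        · rw [hS', List.rotate_append_length_eq]
          simp
      · obtain ⟨rfl, rfl⟩ : v ++ [false] = c ∧ (v ++ [true]) :: N = V := by simpa using hm
        have h0 : ((v ++ [true]) :: N ++ (M ++ [v ++ [false]]))[0]? = some (v ++ [true]) := by simp
        have := (List.getElem?_inj (by simp) hnodup).1 (h0.trans p1.symm)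
        omega
      · obtain ⟨rfl, rfl, rfl⟩ : v ++ [false] = c ∧ v ++ [true] = c' ∧ N = m ++ V := by
          simpa using hm
        refine ⟨(M ++ v :: m).length, V ++ M, m, ?_, by simp, ?_⟩
        · have := List.length_pos_iff.2 hne
          simp [hS']
          omega
        · rw [hS', show M ++ v :: (m ++ V) = (M ++ v :: m) ++ V by simp,
            List.rotate_append_length_eq]
          simp
  -- The removed pairs occupy the same positions in both lists, so the remaining pairs are
  -- unchanged.
  have hCA : A.length = C.length := by
    refine (List.getElem?_inj (List.getElem?_eq_some_iff.1 p0).1 hnodup).1 (p0.trans ?_)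
    simp [hrot]
  have hlen : R'.leaves.length = S'.leaves.length := by
    have := D.same_leaves
    rw [hA, hM] at this
    rw [hR', hS']
    simp only [List.length_append, List.length_cons] at this ⊢
    omega
  refine ⟨⟨R', S', k, hlen, hk⟩, u, v, by simp [hA, hR'], h0, h1, ?_⟩
  have e1 : leafPairs ⟨R', S', k, hlen, hk⟩ = A.zip C ++ (u, v) :: B.zip E := by
    rw [leafPairs, hR', hrot', List.zip_append hCA, List.zip_cons_cons]
  have e2 : D.leafPairs = A.zip C ++ (u ++ [false], v ++ [false]) ::
      (u ++ [true], v ++ [true]) :: B.zip E := by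
    rw [leafPairs, hA, hrot, List.zip_append hCA, List.zip_cons_cons, List.zip_cons_cons]
  intro e he
  rw [e1] at he
  rw [e2]
  simp only [List.mem_append, List.mem_cons] at he ⊢
  tauto

/-- A labeled tree diagram can be reduced if carets with the same children have the same root. -/
theorem exists_isReduced {X : Type*} {P : SemigroupPresentation X}
    (hP : P.IsBinary) (hinj : ∀ {r r' s}, (r, s) ∈ P.rels → (r', s) ∈ P.rels → r = r')
    {x : X} {f : UnitAddCircle → UnitAddCircle} (D : TreeDiagram) (hf : D.Maps f)
    (hx : D.LabeledBy P x) : ∃ D' : TreeDiagram, D'.IsReduced ∧ D'.Maps f ∧ D'.LabeledBy P x := by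
  induction hn : D.input.leaves.length using Nat.strong_induction_on generalizing D with
  | _ n ih =>
    by_cases hD : D.IsReduced
    · exact ⟨D, hD, hf, hx⟩
    obtain ⟨D', u, v, hlt, h0, h1, hsub⟩ := D.exists_reduction hD
    refine ih _ (hn ▸ hlt) D' (fun e he => ?_) (fun e he => ?_) rfl
    · rcases hsub e he with rfl | he
      · intro s hs
        -- The two half intervals are mapped affinely onto the matching halves, so the whole
        -- interval is mapped affinely.
        rcases lt_or_ge s (1 / 2) with h | h
        · have := hf _ h0 (2 * s) ⟨by linarith [hs.1], by linarith⟩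
          simpa [leafPoint_append_singleton] using this
        · have := hf _ h1 (2 * s - 1) ⟨by linarith, by linarith [hs.2]⟩
          simpa [leafPoint_append_singleton] using this
      · exact hf e he
    · rcases hsub e he with rfl | he
      · obtain ⟨y, hy, hy'⟩ := hx _ h0
        obtain ⟨z, hz, hz'⟩ := hx _ h1
        obtain ⟨a, ha, hay⟩ := reach_append_iff.1 hy
        obtain ⟨b, hb, hby⟩ := reach_append_iff.1 hy'
        obtain ⟨a', ha', haz⟩ := reach_append_iff.1 hz
        obtain ⟨b', hb', hbz⟩ := reach_append_iff.1 hz'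
        obtain rfl := ha.unique hP ha'
        obtain rfl := hb.unique hP hb'
        cases hay with
        | cons _ h1 hay =>
          cases hby with
          | cons _ h2 hby =>
            rw [reach_cons_iff hP h1] at haz
            rw [reach_cons_iff hP h2] at hbz
            simp only [Bool.false_eq_true, if_false, if_true, reach_nil_iff] at hay hby haz hbz
            subst hay haz
            subst hby hbz
            -- The labels of the two caret roots have the same left and right children, hence agree
            -- by `hinj`.
            obtain rfl : a = b := by simpa using hinj h1 h2
            exact ⟨a, ha, hb⟩
      · exact hx e he

end TreeDiagram

/-! ### Annular diagrams and tree diagrams -/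

namespace DiagramClass

variable {X : Type*} {P : SemigroupPresentation X}

/-- The piecewise linear map of an annular diagram gives the map `f` of the circle. -/
def Induces {x : X} (d : DiagramClass P [x] [x]) (f : UnitAddCircle → UnitAddCircle) : Prop :=
  ∀ t ∈ Ico (0 : ℝ) 1, f (t : UnitAddCircle) = (d.eval t : UnitAddCircle)

theorem eval_mem_Ico {x : X} (d : DiagramClass P [x] [x]) {t : ℝ} (ht : t ∈ Ico (0 : ℝ) 1) :
    d.eval t ∈ Ico (0 : ℝ) 1 := by
  simpa using (d.eval_range t).2.1 ht.1 (by simpa using ht.2)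

theorem Induces.comp {x : X} {d d' : DiagramClass P [x] [x]} {f f' : UnitAddCircle → UnitAddCircle}
    (h : d.Induces f) (h' : d'.Induces f') : (d ⊚ d').Induces (f' ∘ f) := fun t ht => by
  rw [eval_comp_apply, Function.comp, h t ht, h' _ (d.eval_mem_Ico ht)]

theorem induces_nil (x : X) : (nil [x] : DiagramClass P [x] [x]).Induces id := fun _ _ => rfl

theorem Induces.unique {x : X} {d : DiagramClass P [x] [x]} {f f' : UnitAddCircle → UnitAddCircle}
    (h : d.Induces f) (h' : d.Induces f') : f = f' := by
  ext a
  obtain ⟨t, ht, rfl⟩ := AddCircle.eq_coe_Ico a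
  rw [h t ht, h' t ht]

/-- On `[0, 1)` the value again lies in `[0, 1)`, so equality on the circle lifts to the line;
elsewhere `eval` is the identity because both boundary words have length one. -/
theorem Induces.eq_nil (hP : P.IsBinary) {x : X} {d : DiagramClass P [x] [x]}
    (h : d.Induces id) : d = nil [x] := by
  refine eq_nil_of_eval_eq_id hP d (funext fun t => ?_)
  obtain ⟨h1, -, h3⟩ := d.eval_range t
  rcases lt_or_ge t 0 with h0 | h0
  · exact h1 h0
  rcases lt_or_ge t 1 with ht | ht
  · have := h t ⟨h0, ht⟩
    exact ((AddCircle.coe_eq_coe_iff_of_mem_Ico (a := 0) (by rw [zero_add]; exact ⟨h0, ht⟩)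
      (by rw [zero_add]; exact d.eval_mem_Ico ⟨h0, ht⟩)).1 this).symm
  · simpa using h3 (by simpa using ht)

/-- Nonemptiness of `p` makes `|q|` smaller than the number of leaves, as the offset of a tree
diagram must be. A trivial rotation is rewritten with the full word as `p`. -/
theorem exists_normal_form_of_ne_nil (hP : P.IsBinary) {u v : List X} (hu : u ≠ [])
    (d : DiagramClass P u v) :
    ∃ (u' v' : List X) (e : Expansion P u u') (f : Expansion P v v') (p q : List X)
      (h₁ : u' = p ++ q) (h₂ : v' = q ++ p),
      p ≠ [] ∧ d = e.toClass ⊚ shift p q h₁ h₂ ⊚ f.toClass.inv := by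
  obtain ⟨u', v', e, f, p, q, h₁, h₂, rfl⟩ := d.exists_normal_form hP
  by_cases hp : p = []
  · subst hp
    obtain rfl : v' = u' := by simp [h₁, h₂]
    refine ⟨v', v', e, f, q, [], h₂, h₁, ?_, ?_⟩
    · rintro rfl
      have h := e.strictMono_eval (a := 0) (b := u.length)
        (by exact_mod_cast List.length_pos_iff.2 hu)
      rw [e.eval_zero, e.eval_length, h₁] at h
      simp at h
    · rw [shift_nil_left, shift_nil_right]
  · exact ⟨u', v', e, f, p, q, h₁, h₂, hp, rfl⟩

theorem exists_continuous_induces (hP : P.IsBinary) {x : X} (d : DiagramClass P [x] [x]) :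
    ∃ g : UnitAddCircle → UnitAddCircle, Continuous g ∧ d.Induces g := by
  obtain ⟨u', v', e, f, p, q, h₁, h₂, rfl⟩ := d.exists_normal_form hP
  have hu' : e.toClass.eval 1 = p.length + q.length := by
    have := e.eval_length
    simpa [h₁] using this
  have hf0 : f.toClass.inv.eval 0 = 0 := by
    simpa [f.eval_zero] using f.toClass.eval_inv_eval 0
  have hf1 : f.toClass.inv.eval (p.length + q.length) = 1 := by
    have hv : (v'.length : ℝ) = p.length + q.length := by
      rw [h₂, List.length_append, Nat.cast_add, add_comm]
    rw [← hv, ← f.eval_length, eval_inv_eval]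
    simp
  have h10 : ((1 : ℝ) : UnitAddCircle) = ((0 : ℝ) : UnitAddCircle) := AddCircle.coe_period 1
  have hp : (0 : ℝ) ≤ p.length := by positivity
  have hq : (0 : ℝ) ≤ q.length := by positivity
  -- The rotation jumps at `|p|`, with one-sided values `|p| + |q|` and 0. The inverse expansion
  -- takes these to 1 and 0, which are one point of the circle, so the jump disappears. For the same
  -- reason `≤` may replace the strict inequality of `rotMap`.
  set h : ℝ → UnitAddCircle := fun t =>
    if e.toClass.eval t ≤ p.length then (f.toClass.inv.eval (e.toClass.eval t + q.length) : ℝ)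
    else (f.toClass.inv.eval (e.toClass.eval t - p.length) : ℝ) with hh
  have hcont : Continuous h := by
    have hmk : Continuous ((↑) : ℝ → UnitAddCircle) := AddCircle.continuous_mk' 1
    have h1 := f.continuous_eval_inv
    have h2 := e.continuous_eval
    refine Continuous.if_le (hmk.comp (h1.comp (h2.add continuous_const)))
      (hmk.comp (h1.comp (h2.sub continuous_const))) h2 continuous_const fun t ht => ?_
    rw [ht, hf1, sub_self, hf0, h10]
  have hends : h 0 = h 1 := by
    simp only [hh]
    rw [e.eval_zero, if_pos hp, hu', zero_add]
    split_ifs with hc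
    · have hq0 : (q.length : ℝ) = 0 := by linarith
      simp only [hq0, add_zero] at hf1 ⊢
      rw [hf0, hf1, h10]
    · rw [add_sub_cancel_left]
  refine ⟨AddCircle.liftIco 1 0 h, AddCircle.liftIco_zero_continuous hends hcont.continuousOn,
    fun t ht => ?_⟩
  rw [AddCircle.liftIco_zero_coe_apply ht, eval_comp_apply, eval_comp_apply, eval_shift]
  have h0 : 0 ≤ e.toClass.eval t := by
    rw [← e.eval_zero]
    exact e.strictMono_eval.monotone ht.1
  have h1 : e.toClass.eval t < p.length + q.length := by
    rw [← hu']
    exact e.strictMono_eval ht.2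
  simp only [hh]
  rcases lt_trichotomy (e.toClass.eval t) p.length with hlt | heq | hgt
  · rw [if_pos hlt.le, rotMap, if_neg (not_lt.2 h0), if_pos hlt]
  · rw [heq] at h1 ⊢
    rw [if_pos le_rfl, rotMap, if_neg (not_lt.2 hp), if_neg (lt_irrefl _), if_pos h1, hf1,
      sub_self, hf0, h10]
  · rw [if_neg (not_le.2 hgt), rotMap, if_neg (not_lt.2 h0), if_neg (not_lt.2 hgt.le), if_pos h1]

/-- An annular diagram gives a homeomorphism of the circle. -/
theorem exists_homeomorph_induces (hP : P.IsBinary) {x : X} (d : DiagramClass P [x] [x]) :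
    ∃ g : UnitAddCircle ≃ₜ UnitAddCircle, d.Induces g := by
  obtain ⟨g, hg, hdg⟩ := d.exists_continuous_induces hP
  obtain ⟨g', hg', hdg'⟩ := d.inv.exists_continuous_induces hP
  have h1 := hdg.comp hdg'
  have h2 := hdg'.comp hdg
  rw [comp_inv] at h1
  rw [inv_comp] at h2
  exact ⟨⟨⟨g, g', congrFun (h1.unique (induces_nil x)), congrFun (h2.unique (induces_nil x))⟩,
    hg, hg'⟩, hdg⟩

/-- The homeomorphism of an annular diagram is given by a labeled tree diagram. -/
theorem exists_treeDiagram (hP : P.IsBinary) {x : X} (d : DiagramClass P [x] [x])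
    {g : UnitAddCircle → UnitAddCircle} (hg : d.Induces g) :
    ∃ D : TreeDiagram, D.Maps g ∧ D.LabeledBy P x := by
  obtain ⟨u', v', e, f, p, q, h₁, h₂, hp, rfl⟩ :=
    d.exists_normal_form_of_ne_nil hP (List.cons_ne_nil _ _)
  have hleaf : List.Forall₂ (Reach P x) FullTree.leaf.leaves [x] := .cons (.nil x) .nil
  have hid : IsChart .leaf id := fun j u hu s _ => by
    obtain ⟨rfl, rfl⟩ : j = 0 ∧ u = [] := by
      cases j <;> simp_all [FullTree.leaves]
    simp [leafPoint_nil]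
  obtain ⟨R, hR, hRc⟩ := exists_tree_of_expansion e .leaf hleaf id hid
  obtain ⟨S, hS, hSc⟩ := exists_tree_of_expansion f .leaf hleaf id hid
  have hRl := hR.length_eq
  have hSl := hS.length_eq
  have hpl := List.length_pos_iff.2 hp
  have hpq : p.length + q.length = S.leaves.length := by
    rw [hSl, h₂, List.length_append, add_comm]
  let D : TreeDiagram := ⟨R, S, q.length, by rw [hRl, hSl, h₁, h₂]; simp [add_comm], by omega⟩
  refine ⟨D, fun a ha s hs => ?_, fun a ha => ?_⟩
  · have h := D.rotMap_chart hRc hSc hpq ha hs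
    rw [hg _ (leafPoint_mem _ hs), eval_comp_apply, eval_comp_apply, eval_shift]
    rw [Function.comp_id, Function.comp_id] at h
    erw [h]
    rw [eval_inv_eval]
  -- The leaves of the output tree are labeled by `q p`; rotated by `|q|` they carry `p q = u'`, the
  -- labels of the input leaves.
  · have hrot : List.Forall₂ (Reach P x) (S.leaves.rotate q.length) u' := by
      rw [h₂] at hS
      obtain ⟨A, B, hAB, hA, hB⟩ := forall₂_append_right hS
      rw [hAB, ← hA.length_eq, List.rotate_append_length_eq, h₁]
      exact List.rel_append hB hA
    obtain ⟨j, hj⟩ := List.mem_iff_getElem?.1 ha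
    obtain ⟨hj1, hj2⟩ := List.getElem?_zip_eq_some.1 hj
    obtain ⟨hlt1, hj1⟩ := List.getElem?_eq_some_iff.1 hj1
    obtain ⟨hlt2, hj2⟩ := List.getElem?_eq_some_iff.1 hj2
    have hlt : j < u'.length := hRl ▸ hlt1
    have r1 : Reach P x D.input.leaves[j] u'[j] := hR.get hlt1 hlt
    have r2 : Reach P x (D.output.leaves.rotate D.offset)[j] u'[j] := hrot.get hlt2 hlt
    exact ⟨u'[j], hj1 ▸ r1, hj2 ▸ r2⟩

end DiagramClass

/-- A labeled tree diagram gives an annular diagram. -/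
theorem TreeDiagram.LabeledBy.exists_diagramClass {X : Type*} {P : SemigroupPresentation X}
    (hP : P.IsBinary) {x : X} {D : TreeDiagram} (hD : D.LabeledBy P x)
    {g : UnitAddCircle → UnitAddCircle} (hg : D.Maps g) :
    ∃ d : DiagramClass P [x] [x], d.Induces g := by
  have : Nonempty X := ⟨x⟩
  choose! y hy using hD
  have hlen : D.input.leaves.length = (D.output.leaves.rotate D.offset).length := by
    rw [List.length_rotate, D.same_leaves]
  have h1 : List.Forall₂ (Reach P x) D.input.leaves (D.leafPairs.map y) := by
    rw [← List.map_fst_zip hlen.le]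
    exact List.forall₂_map_left_iff.2 (List.forall₂_map_right_iff.2
      (List.forall₂_same.2 fun e he => (hy e he).1))
  have h2 : List.Forall₂ (Reach P x) (D.output.leaves.rotate D.offset) (D.leafPairs.map y) := by
    rw [← List.map_snd_zip hlen.ge]
    exact List.forall₂_map_left_iff.2 (List.forall₂_map_right_iff.2
      (List.forall₂_same.2 fun e he => (hy e he).2))
  rw [List.rotate_eq_drop_append_take D.offset_lt.le] at h2
  -- The common labels, read from the first input leaf, form `p q`, where `q` labels the first
  -- `offset` output leaves. In its own order the output tree therefore carries `q p`.
  obtain ⟨p, q, hpq, hp, hq⟩ := forall₂_append_left h2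
  have h3 : List.Forall₂ (Reach P x) D.output.leaves (q ++ p) := by
    rw [← List.take_append_drop D.offset D.output.leaves]
    exact List.rel_append hq hp
  have hql : q.length = D.offset := by
    rw [← hq.length_eq, List.length_take_of_le D.offset_lt.le]
  have hpl : p.length + D.offset = D.output.leaves.length := by
    rw [h3.length_eq, List.length_append, hql, add_comm]
  obtain ⟨e, -, -, he⟩ := exists_expansion_of_tree hP D.input h1 [] [] (u := [x])
    (w := D.leafPairs.map y) rfl (by simp)
  obtain ⟨f, -, -, hf⟩ := exists_expansion_of_tree hP D.output h3 [] [] (u := [x])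
    (w := q ++ p) rfl (by simp)
  simp only [List.length_nil, Nat.cast_zero, zero_add, sub_zero] at he hf
  refine ⟨e.toClass ⊚ .shift p q hpq rfl ⊚ f.toClass.inv, fun t ht => ?_⟩
  obtain ⟨a, ha, s, hs, hat⟩ := D.exists_eq_leafPoint (t : UnitAddCircle)
  obtain rfl : t = leafPoint a.1 s :=
    (AddCircle.coe_eq_coe_iff_of_mem_Ico (a := 0) (by rwa [zero_add])
      (by rw [zero_add]; exact leafPoint_mem _ hs)).1 hat
  rw [hg a ha s hs, DiagramClass.eval_comp_apply, DiagramClass.eval_comp_apply,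
    DiagramClass.eval_shift, hql, D.rotMap_chart he hf hpl ha hs, DiagramClass.eval_inv_eval]

/-! ### The core -/

section Core

variable {G : Set ThompsonT}

theorem IsChild.exists_sibling {b : Bool} {x y : PreVertex G} (h : IsChild b x y) (b' : Bool) :
    ∃ y', IsChild b' x y' := by
  cases h with
  | mk D side w hw hw' => exact ⟨_, .mk D side w hw (FullTree.sibling_mem_vertices _ hw' b')⟩

/-- The first folding rule; it is the source of determinism of the presentation. -/
theorem CoreEdge.unique {b : Bool} {x y y' : CoreVertex G} (h : CoreEdge G b x y)
    (h' : CoreEdge G b x y') : y = y' := by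
  obtain ⟨a, c, hac, rfl, rfl⟩ := h
  obtain ⟨a', c', hac', ha, rfl⟩ := h'
  exact Quotient.sound (.child b (Quotient.exact ha.symm) hac hac')

theorem CoreEdge.exists_caret {x y z : CoreVertex G} (h : CoreEdge G false x y)
    (h' : CoreEdge G true x z) :
    ∃ a l r : PreVertex G, IsChild false a l ∧ IsChild true a r ∧
      Quotient.mk (coreSetoid G) a = x ∧ Quotient.mk (coreSetoid G) l = y ∧
      Quotient.mk (coreSetoid G) r = z := by
  obtain ⟨a, l, hal, rfl, rfl⟩ := h
  obtain ⟨r, har⟩ := hal.exists_sibling true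
  exact ⟨a, l, r, hal, har, rfl, rfl, CoreEdge.unique ⟨a, r, har, rfl, rfl⟩ h'⟩

theorem CoreEdge.exists_sibling {b : Bool} {x y : CoreVertex G} (h : CoreEdge G b x y)
    (b' : Bool) : ∃ y', CoreEdge G b' x y' := by
  obtain ⟨a, l, hal, rfl, rfl⟩ := h
  obtain ⟨r, har⟩ := hal.exists_sibling b'
  exact ⟨_, a, r, har, rfl, rfl⟩

theorem mem_corePresentation_iff {x y z : CoreVertex G} :
    ([x], [y, z]) ∈ (corePresentation G).rels ↔ CoreEdge G false x y ∧ CoreEdge G true x z := by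
  constructor
  · rintro ⟨x', y', z', h1, h2, h⟩
    obtain ⟨rfl, rfl, rfl⟩ : x = x' ∧ y = y' ∧ z = z' := by simpa using h
    exact ⟨h1, h2⟩
  · rintro ⟨h1, h2⟩
    exact ⟨x, y, z, h1, h2, rfl⟩

theorem corePresentation_isBinary (G : Set ThompsonT) : (corePresentation G).IsBinary where
  shape := by
    rintro e ⟨x, y, z, -, -, rfl⟩
    exact ⟨x, y, z, rfl⟩
  det := by
    rintro x s s' ⟨a, y, z, h1, h2, h⟩ ⟨a', y', z', h1', h2', h'⟩
    obtain ⟨rfl, rfl⟩ : x = a ∧ s = [y, z] := by simpa using h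
    obtain ⟨rfl, rfl⟩ : x = a' ∧ s' = [y', z'] := by simpa using h'
    rw [h1.unique h1', h2.unique h2']

/-- The second folding rule, needed for reducing labeled tree diagrams. -/
theorem corePresentation_injective {r r' s : List (CoreVertex G)}
    (h : (r, s) ∈ (corePresentation G).rels) (h' : (r', s) ∈ (corePresentation G).rels) :
    r = r' := by
  obtain ⟨x, y, z, h1, h2, h⟩ := h
  obtain ⟨x', y', z', h1', h2', h'⟩ := h'
  obtain ⟨rfl, rfl⟩ : r = [x] ∧ s = [y, z] := by simpa using h
  obtain ⟨rfl, rfl, rfl⟩ : r' = [x'] ∧ y = y' ∧ z = z' := by simpa using h'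
  obtain ⟨a, b, c, ha, ha', rfl, rfl, rfl⟩ := h1.exists_caret h2
  obtain ⟨a', b', c', hb, hb', rfl, hl, hr⟩ := h1'.exists_caret h2'
  rw [show Quotient.mk (coreSetoid G) a = Quotient.mk (coreSetoid G) a' from
    Quotient.sound (.parent ha ha' hb hb' (Quotient.exact hl.symm) (Quotient.exact hr.symm))]

theorem reach_singleton_iff {b : Bool} {x y : CoreVertex G} :
    Reach (corePresentation G) x [b] y ↔ CoreEdge G b x y := by
  constructor
  · intro h
    cases h with
    | cons _ h ht =>
      obtain ⟨h1, h2⟩ := mem_corePresentation_iff.1 h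
      obtain rfl := reach_nil_iff.1 ht
      cases b
      · exact h1
      · exact h2
  · intro h
    obtain ⟨z, hz⟩ := h.exists_sibling (!b)
    cases b
    · exact .cons false (mem_corePresentation_iff.2 ⟨h, hz⟩) (.nil y)
    · exact .cons true (mem_corePresentation_iff.2 ⟨hz, h⟩) (.nil y)

/-- By induction along the path, a homomorphism sends each tree vertex to an endpoint of the path in
the core with the same labels; identified leaves share that endpoint. -/
theorem IsCoreHom.labeledBy {D : TreeDiagram} {φ : Bool → List Bool → CoreVertex G}
    (h : IsCoreHom G D φ) : D.LabeledBy (corePresentation G) (coreRoot G) := by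
  have key : ∀ (side : Bool) (w : List Bool), w ∈ (D.tree side).vertices →
      Reach (corePresentation G) (coreRoot G) w (φ side w) := by
    intro side w
    induction w using List.reverseRecOn with
    | nil => exact fun _ => h.map_root side ▸ .nil _
    | append_singleton w b ih =>
      intro hw
      exact (ih (FullTree.vertices_of_append _ hw)).append
        (reach_singleton_iff.2 (h.map_edge side w b hw))
  intro e he
  have hmem := List.of_mem_zip he
  refine ⟨φ false e.1, key false e.1 ?_, h.map_leaf e.1 e.2 he ▸ key true e.2 ?_⟩
  · exact (FullTree.mem_vertices_iff _ _).2 ⟨[], by simpa [TreeDiagram.tree] using hmem.1⟩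
  · exact (FullTree.mem_vertices_iff _ _).2
      ⟨[], by simpa [TreeDiagram.tree] using List.mem_rotate.1 hmem.2⟩

theorem TreeDiagram.LabeledBy.exists_isCoreHom {D : TreeDiagram}
    (h : D.LabeledBy (corePresentation G) (coreRoot G)) : ∃ φ, IsCoreHom G D φ := by
  classical
  have hP := corePresentation_isBinary G
  -- The same function serves both trees: it follows the path from the root of the core, and takes
  -- the root as a default value for paths that do not exist there.
  let ψ : List Bool → CoreVertex G := fun w =>
    if hw : ∃ y, Reach (corePresentation G) (coreRoot G) w y then hw.choose else coreRoot G
  have hψ : ∀ {w y}, Reach (corePresentation G) (coreRoot G) w y → ψ w = y := by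
    intro w y hy
    have hw : ∃ y, Reach (corePresentation G) (coreRoot G) w y := ⟨y, hy⟩
    simp only [ψ, dif_pos hw]
    exact hw.choose_spec.unique hP hy
  have hleaf : ∀ side, ∀ w ∈ (D.tree side).leaves,
      ∃ y, Reach (corePresentation G) (coreRoot G) w y := by
    rintro (_ | _) w hw
    · obtain ⟨v, hv⟩ := D.exists_mem_leafPairs hw
      obtain ⟨y, hy, -⟩ := h _ hv
      exact ⟨y, hy⟩
    · have hs : D.leafPairs.map Prod.snd = D.output.leaves.rotate D.offset :=
        List.map_snd_zip (by rw [List.length_rotate, D.same_leaves])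
      have hw' : w ∈ D.leafPairs.map Prod.snd := by
        rw [hs]
        exact List.mem_rotate.2 hw
      obtain ⟨e, he, rfl⟩ := List.mem_map.1 hw'
      obtain ⟨y, -, hy⟩ := h _ he
      exact ⟨y, hy⟩
  refine ⟨fun _ => ψ, fun _ => hψ (.nil _), fun side w b hw => ?_, fun u v huv => ?_⟩
  · obtain ⟨w', hw'⟩ := (FullTree.mem_vertices_iff _ _).1 hw
    obtain ⟨y, hy⟩ := hleaf side _ hw'
    obtain ⟨z, hz, -⟩ := reach_append_iff.1 hy
    obtain ⟨t, ht, htz⟩ := reach_append_iff.1 hz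
    rw [hψ hz, hψ ht]
    exact reach_singleton_iff.1 htz
  · obtain ⟨y, hy, hy'⟩ := h _ huv
    rw [hψ hy, hψ hy']

/-- The accepted elements are the homeomorphisms of the annular diagrams. -/
theorem exists_induces_of_mem_coreAccepted {f : ThompsonT} (hf : f ∈ coreAccepted G) :
    ∃ d : DiagramClass (corePresentation G) [coreRoot G] [coreRoot G], d.Induces f.1 := by
  obtain ⟨D, -, hDf, φ, hφ⟩ := hf
  exact hφ.labeledBy.exists_diagramClass (corePresentation_isBinary G) hDf.maps

theorem exists_mem_coreAccepted_of_diagramClass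
    (d : DiagramClass (corePresentation G) [coreRoot G] [coreRoot G]) :
    ∃ f ∈ coreAccepted G, d.Induces f.1 := by
  have hP := corePresentation_isBinary G
  obtain ⟨g, hg⟩ := d.exists_homeomorph_induces hP
  obtain ⟨D, hDg, hD⟩ := d.exists_treeDiagram hP hg
  obtain ⟨D', hred, hmaps, hlab⟩ := D.exists_isReduced hP corePresentation_injective hDg hD
  exact ⟨⟨g, hDg.isDyadicPL⟩, ⟨D', hred, hmaps, hlab.exists_isCoreHom⟩, hg⟩

end Core

end StallingsCore

/-! ### The isomorphism -/

theorem mainTheorem9 (H : Subgroup StallingsCore.ThompsonT) (G : Set StallingsCore.ThompsonT)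
    (hG : Subgroup.closure G = H)
    (hC : (H : Set StallingsCore.ThompsonT) = StallingsCore.coreAccepted G) :
    Nonempty (H ≃* StallingsCore.AnnularDiagramGroup (StallingsCore.corePresentation G)
      [StallingsCore.coreRoot G]) := by
  open StallingsCore in
  have hP := corePresentation_isBinary G
  choose f hf hdf using exists_mem_coreAccepted_of_diagramClass (G := G)
  -- A diagram induces only one map of the circle, so the chosen `f` is automatically compatible
  -- with nesting.
  have huniq : ∀ (d : DiagramClass (corePresentation G) [coreRoot G] [coreRoot G])
      (g : ThompsonT), d.Induces g.1 → f d = g := fun d g hg =>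
    Subtype.ext (Homeomorph.ext (congrFun ((hdf d).unique hg)))
  have hcomp : ∀ d d', f (d.comp d') = f d' * f d := fun d d' =>
    huniq _ _ ((hdf d).comp (hdf d'))
  have hnil : f (DiagramClass.nil _) = 1 := huniq _ _ (DiagramClass.induces_nil _)
  have hmem : ∀ d, f d ∈ H := fun d => by
    rw [← SetLike.mem_coe, hC]
    exact hf d
  -- The outer diagram acts first, so `f` reverses products; inverting its values gives a
  -- homomorphism.
  let F : AnnularDiagramGroup (corePresentation G) [coreRoot G] →* H := MonoidHom.mk'
    (fun d => ⟨f d, hmem d⟩⁻¹) fun d d' => by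
      rw [← mul_inv_rev]
      exact congrArg _ (Subtype.ext (hcomp d d'))
  refine ⟨(MulEquiv.ofBijective F ⟨(injective_iff_map_eq_one F).2 fun d hd => ?_, fun g => ?_⟩).symm⟩
  · have hfd : f d = 1 := congrArg Subtype.val (inv_eq_one.1 hd)
    have h := hdf d
    rw [hfd] at h
    exact h.eq_nil hP
  · have hg : (g⁻¹ : H).1 ∈ coreAccepted G := by
      rw [← hC]
      exact (g⁻¹).2
    obtain ⟨d, hd⟩ := exists_induces_of_mem_coreAccepted hg
    refine ⟨d, ?_⟩
    change (⟨f d, hmem d⟩ : H)⁻¹ = g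
    rw [inv_eq_iff_eq_inv]
    exact Subtype.ext (huniq d _ hd)
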